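/- For $\alpha\in(-1,1)$ and an integer $m\ge 0$ let $p_m(\cdot;\alpha)$ be the best uniform approximation on $[-1,1]$ to $f(x)=|x-\alpha|$ by real polynomials of degree at most $m$, and let $E_m(\alpha)=\max_{x\in[-1,1]}\bigl||x-\alpha|-p_m(x;\alpha)\bigr|$. The alternation set $\mathcal A_m(\alpha)$ is the set of all points belonging to some sequence $-1\le z_1<\dots<z_N\le 1$ with $N\ge m+2$ and $|z_i-\alpha|-p_m(z_i;\alpha)=\epsilon(-1)^iE_m(\alpha)$ for $i=1,\dots,N$ and some $\epsilon\in\{1,-1\}$. A V-shape of $E_m$ with tip $b$ is an interval $[a,c]\subset(-1,1)$ with $a<b<c$ such that $E_m$ is affine and strictly decreasing on $[a,b]$ and affine and strictly increasing on $[b,c]$; the points of $[a,c]$ are said to be part of it. Fix an integer $n\ge 2$ and for $\alpha\in(-1,1)$ let $$g_\alpha(x)=\frac{p_n(x;\alpha)-|x-\alpha|}{E_n(\alpha)},\qquad x\in\mathbb R .$$ (i) Let $\alpha\in(-1,1)$ be such that $\{-1,1\}\subset\mathcal A_n(\alpha)$, and suppose that $\alpha$ is neither the tip of a V-shape of $E_{n-1}$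 nor part of a V-shape of $E_n$. Then there exists $w\in\mathbb R\setminus[-1,1]$ with $g_\alpha'(w)=0$. (ii) Let $I\subset(-1,1)$ be an interval such that for every $\alpha\in I$ there is a point $w(\alpha)\in\mathbb R\setminus[-1,1]$ with $g_\alpha'(w(\alpha))=0$. Then $\alpha\mapsto w(\alpha)$ is strictly increasing on $I$. -/

import Mathlib

open Set

noncomputable section

/-- The checkmark function `x ↦ |x - α|` as an element of `C([-1,1], ℝ)`. -/
def checkmark (α : ℝ) : C(Icc (-1 : ℝ) 1, ℝ) :=
  ⟨fun x => |(x : ℝ) - α|, by fun_prop⟩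

/-- The uniform norm on `[-1,1]` of `|x - α| - q(x)`. -/
def approxError (α : ℝ) (q : Polynomial ℝ) : ℝ :=
  ‖checkmark α - q.toContinuousMapOn (Icc (-1 : ℝ) 1)‖

/-- `p` is a best uniform approximation on `[-1,1]`, among real polynomials of degree at most `n`,
to the checkmark function with corner `α`. -/
def IsMinimax (n : ℕ) (α : ℝ) (p : Polynomial ℝ) : Prop :=
  p.natDegree ≤ n ∧ ∀ q : Polynomial ℝ, q.natDegree ≤ n → approxError α p ≤ approxError α q

theorem exists_isMinimax (n : ℕ) (α : ℝ) : ∃ p, IsMinimax n α p := by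
  let L : Polynomial ℝ →ₗ[ℝ] C(Icc (-1 : ℝ) 1, ℝ) :=
    (Polynomial.toContinuousMapOnAlgHom (Icc (-1 : ℝ) 1)).toLinearMap
  let S : Submodule ℝ C(Icc (-1 : ℝ) 1, ℝ) := (Polynomial.degreeLT ℝ (n + 1)).map L
  have : FiniteDimensional ℝ (Polynomial.degreeLT ℝ (n + 1)) :=
    LinearEquiv.finiteDimensional (Polynomial.degreeLTEquiv ℝ (n + 1)).symm
  have : FiniteDimensional ℝ S := inferInstance
  have : ProperSpace S := FiniteDimensional.proper ℝ S
  have hmem : ∀ q : Polynomial ℝ, q ∈ Polynomial.degreeLT ℝ (n + 1) ↔ q.natDegree ≤ n := by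
    intro q
    rw [Polynomial.mem_degreeLT, Polynomial.degree_lt_iff_coeff_zero,
      Polynomial.natDegree_le_iff_coeff_eq_zero]
    exact Iff.rfl
  have hcont : Continuous fun s : S => ‖checkmark α - (s : C(Icc (-1 : ℝ) 1, ℝ))‖ := by fun_prop
  have hlim : Filter.Tendsto (fun s : S => ‖checkmark α - (s : C(Icc (-1 : ℝ) 1, ℝ))‖)
      (Filter.cocompact S) Filter.atTop := by
    have h1 : Filter.Tendsto (fun s : S => ‖s‖ - ‖checkmark α‖)
        (Filter.cocompact S) Filter.atTop :=
      Filter.tendsto_atTop_add_const_right _ _ (tendsto_norm_cocompact_atTop (E := S))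
    refine Filter.tendsto_atTop_mono (fun s => ?_) h1
    rw [norm_sub_rev]
    exact norm_sub_norm_le (s : C(Icc (-1 : ℝ) 1, ℝ)) (checkmark α)
  obtain ⟨s, hs⟩ := hcont.exists_forall_le hlim
  obtain ⟨p, hp, hps⟩ := Submodule.mem_map.1 s.2
  refine ⟨p, (hmem p).1 hp, fun q hq => ?_⟩
  have h := hs ⟨L q, Submodule.mem_map_of_mem ((hmem q).2 hq)⟩
  rw [← hps] at h
  exact h

/-- The minimax polynomial `p_n(·; α)`. -/
def minimaxPoly (n : ℕ) (α : ℝ) : Polynomial ℝ :=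
  Classical.choose (exists_isMinimax n α)

/-- The minimax error `E_n(α)`. -/
def minimaxError (n : ℕ) (α : ℝ) : ℝ :=
  approxError α (minimaxPoly n α)

/-- The alternation set: all points of `[-1,1]` that occur in an increasing sequence of at least
`n + 2` points of `[-1,1]` at which the error of the minimax polynomial attains the values
`± E_n(α)` with alternating signs. -/
def alternationSet (n : ℕ) (α : ℝ) : Set ℝ :=
  {z | ∃ N : ℕ, n + 2 ≤ N ∧ ∃ s : Fin N → ℝ, StrictMono s ∧ (∀ i, s i ∈ Icc (-1 : ℝ) 1) ∧
    (∃ ε : ℝ, (ε = 1 ∨ ε = -1) ∧ ∀ i : Fin N,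
      |s i - α| - (minimaxPoly n α).eval (s i) = ε * (-1) ^ (i : ℕ) * minimaxError n α) ∧
    z ∈ Set.range s}

/-- The normalized error `g_α`, as a function on the whole real line. -/
def normalizedError (n : ℕ) (α x : ℝ) : ℝ :=
  ((minimaxPoly n α).eval x - |x - α|) / minimaxError n α

/-- The graph of `E_n` has a V-shape over `[a,c] ⊆ (-1,1)` with tip `b ∈ (a,c)`: `E_n` is
decreasing and linear on `[a,b]`, and increasing and linear on `[b,c]` (which makes it continuous
on `[a,c]`). A V-shape is not required to be maximal; a smaller one has the same tip. -/
def IsVShape (n : ℕ) (a b c : ℝ) : Prop :=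
  -1 < a ∧ a < b ∧ b < c ∧ c < 1 ∧
    (∃ m < 0, ∀ x ∈ Icc a b, minimaxError n x = minimaxError n b + m * (x - b)) ∧
    (∃ m > 0, ∀ x ∈ Icc b c, minimaxError n x = minimaxError n b + m * (x - b))

/-- `α` is the tip of a V-shape of `E_n`. -/
def IsVShapeTip (n : ℕ) (α : ℝ) : Prop :=
  ∃ a c, IsVShape n a α c

/-- `α` is part of a V-shape of `E_n`, endpoints included. -/
def InVShape (n : ℕ) (α : ℝ) : Prop :=
  ∃ a b c, IsVShape n a b c ∧ α ∈ Icc a c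

/-- `w` is a critical point of the normalized error `g_α` outside `[-1,1]`. -/
def IsOutsideCritical (n : ℕ) (α w : ℝ) : Prop :=
  w ∉ Icc (-1 : ℝ) 1 ∧ HasDerivAt (normalizedError n α) 0 w

end

/-!
Write `r` for the residual `|x - α| - p_n(x; α)`.

Part (i). Rescaling a piece of the error curve on which `n + 2` alternation points survive gives a
minimax problem on `[-1, 1]` with another corner, so `n + 3` alternation points force a V-shape:
one may cut off a bit of the interval on either side. In particular `p_n` has degree exactly `n`, as
otherwise `α` would be the tip of a V-shape of `E_{n-1}`. Hence on one side of `[-1, 1]`, say the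
right one, the residual tends to infinity with the sign opposite to that of `r 1`. If it has no
critical point there, it is monotone and reaches the next alternation value at some `u > 1`; the
`n + 3` alternation points in `[-1, u]` then place `α` in a V-shape of `E_n`.

Part (ii). When there is an outside critical point, `α` itself is an alternation point:
otherwise the derivative of `r` would have too many zeros. The index of this alternation point
and the side of the critical point are locally constant in `α`, because `p_n` depends
continuously on `α`. For `α < β` in `I` one compares the left and the right polynomial pieces of
the two normalized residuals. The differences of the left pieces and of the right pieces have
the same second derivative, so their sign alternations on both sides of the corners add up. If
the critical points were in the wrong order, this second derivative would change sign too often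
for its degree.
-/

namespace Checkmark

open Polynomial

/-- The values of `f` at the nodes `x a < ⋯ < x b` weakly alternate in sign: at `x i` the value
vanishes or has the sign of `σ * (-1) ^ i`. -/
structure WeaklyAlternates (σ : ℝ) (f : ℝ[X]) (x : ℕ → ℝ) (a b : ℕ) : Prop where
  strictMonoOn : StrictMonoOn x (Icc a b)
  nonneg : ∀ i ∈ Icc a b, 0 ≤ σ * (-1) ^ i * f.eval (x i)

lemma neg_one_pow_mul_self (i : ℕ) : (-1 : ℝ) ^ i * (-1) ^ i = 1 := by
  rw [← mul_pow]; simp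

lemma neg_one_pow_sub {i j : ℕ} (h : j ≤ i) : (-1 : ℝ) ^ (i - j) = (-1) ^ i * (-1) ^ j := by
  rw [← pow_add]
  exact neg_one_pow_congr (by grind)

lemma prod_sub_eq_neg_one_pow_mul {x : ℕ → ℝ} {a b i : ℕ} (hx : StrictMonoOn x (Icc a b))
    (hi : i ∈ Finset.Icc a b) :
    ∏ j ∈ (Finset.Icc a b).erase i, (x i - x j) =
      (-1) ^ (b - i) * ∏ j ∈ (Finset.Icc a b).erase i, |x i - x j| := by
  have hcard : {j ∈ (Finset.Icc a b).erase i | i < j} = Finset.Ioc i b := by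
    ext j; simp only [Finset.mem_filter, Finset.mem_erase, Finset.mem_Icc, Finset.mem_Ioc] at *; lia
  have hsign : ∏ j ∈ (Finset.Icc a b).erase i, (if i < j then (-1 : ℝ) else 1)
      = (-1) ^ (b - i) := by
    rw [Finset.prod_ite, Finset.prod_const, Finset.prod_const_one, mul_one, hcard, Nat.card_Ioc]
  rw [← hsign, ← Finset.prod_mul_distrib]
  refine Finset.prod_congr rfl fun j hj => ?_
  obtain ⟨hji, hj⟩ := Finset.mem_erase.1 hj
  simp only [Finset.mem_Icc] at hi hj
  split_ifs with hij
  · rw [abs_of_neg (sub_neg.2 (hx hi hj hij))]; ring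
  · rw [abs_of_pos (sub_pos.2 (hx hj hi (by lia))), one_mul]

-- The weights come from Lagrange interpolation at the nodes.
lemma exists_pos_weights_coeff_eq {x : ℕ → ℝ} {a b : ℕ} (hab : a ≤ b)
    (hx : StrictMonoOn x (Icc a b)) :
    ∃ c : ℕ → ℝ, (∀ i ∈ Finset.Icc a b, 0 < c i) ∧ ∀ f : ℝ[X], f.natDegree ≤ b - a →
      (-1) ^ b * f.coeff (b - a) = ∑ i ∈ Finset.Icc a b, c i * ((-1) ^ i * f.eval (x i)) := by
  have hinj : InjOn x (Finset.Icc a b) := by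
    rw [Finset.coe_Icc]; exact hx.injOn
  have hcard : (Finset.Icc a b).card = b - a + 1 := by rw [Nat.card_Icc]; lia
  refine ⟨fun i => (∏ j ∈ (Finset.Icc a b).erase i, |x i - x j|)⁻¹, fun i hi => ?_,
    fun f hf => ?_⟩
  · refine inv_pos.2 (Finset.prod_pos fun j hj => abs_pos.2 (sub_ne_zero.2 fun h => ?_))
    obtain ⟨hji, hj⟩ := Finset.mem_erase.1 hj
    exact hji (hinj hj hi h.symm)
  · have hdeg : f.degree < (Finset.Icc a b).card := by
      rw [hcard]
      exact (degree_le_of_natDegree_le hf).trans_lt (by exact_mod_cast Nat.lt_succ_self _)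
    have hcoeff := Lagrange.coeff_eq_sum hinj hdeg
    rw [hcard, Nat.add_sub_cancel] at hcoeff
    rw [hcoeff, Finset.mul_sum]
    refine Finset.sum_congr rfl fun i hi => ?_
    rw [prod_sub_eq_neg_one_pow_mul hx hi, neg_one_pow_sub (Finset.mem_Icc.1 hi).2]
    rcases neg_one_pow_eq_or ℝ i with h | h <;> rcases neg_one_pow_eq_or ℝ b with h' | h' <;>
      rw [h, h'] <;> ring

namespace WeaklyAlternates

variable {σ : ℝ} {f : ℝ[X]} {x y : ℕ → ℝ} {a b c : ℕ}

lemma mono {a' b' : ℕ} (h : WeaklyAlternates σ f x a b) (ha : a ≤ a') (hb : b' ≤ b) :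
    WeaklyAlternates σ f x a' b' :=
  ⟨h.strictMonoOn.mono (Icc_subset_Icc ha hb), fun i hi => h.nonneg i (Icc_subset_Icc ha hb hi)⟩

lemma shift {k : ℕ} (h : WeaklyAlternates σ f x (a + k) (b + k)) :
    WeaklyAlternates (σ * (-1) ^ k) f (fun i => x (i + k)) a b := by
  have hmem : ∀ i ∈ Icc a b, i + k ∈ Icc (a + k) (b + k) := fun i hi =>
    ⟨Nat.add_le_add_right hi.1 k, Nat.add_le_add_right hi.2 k⟩
  refine ⟨fun i hi j hj hij => h.strictMonoOn (hmem i hi) (hmem j hj) (by lia), fun i hi => ?_⟩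
  have := h.nonneg _ (hmem i hi)
  rwa [add_comm i k, pow_add, ← mul_assoc, add_comm k i] at this

lemma singleton {w : ℝ} (h : 0 ≤ σ * (-1) ^ a * f.eval w) :
    WeaklyAlternates σ f (fun _ => w) a a := by
  refine ⟨by simp, fun i hi => ?_⟩
  rwa [le_antisymm hi.2 hi.1]

lemma append (h₁ : WeaklyAlternates σ f x a b) (h₂ : WeaklyAlternates σ f y (b + 1) c)
    (hxy : b < c → x b < y (b + 1)) :
    WeaklyAlternates σ f (fun i => if i ≤ b then x i else y i) a c := by
  refine ⟨fun i hi j hj hij => ?_, fun i hi => ?_⟩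
  · split_ifs with hib hjb hjb
    · exact h₁.strictMonoOn ⟨hi.1, hib⟩ ⟨hj.1, hjb⟩ hij
    · have hbc : b < c := (not_le.1 hjb).trans_le hj.2
      calc x i ≤ x b := h₁.strictMonoOn.monotoneOn ⟨hi.1, hib⟩ ⟨hi.1.trans hib, le_rfl⟩ hib
        _ < y (b + 1) := hxy hbc
        _ ≤ y j := h₂.strictMonoOn.monotoneOn ⟨le_rfl, hbc⟩ ⟨not_le.1 hjb, hj.2⟩ (not_le.1 hjb)
    · lia
    · exact h₂.strictMonoOn ⟨not_le.1 hib, hi.2⟩ ⟨not_le.1 hjb, hj.2⟩ hij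
  · split_ifs with hib
    · exact h₁.nonneg i ⟨hi.1, hib⟩
    · exact h₂.nonneg i ⟨not_le.1 hib, hi.2⟩

lemma coeff_pos (h : WeaklyAlternates σ f x a b) (hσ : σ ≠ 0) (hab : a ≤ b)
    (hdeg : f.natDegree ≤ b - a) (hf : f ≠ 0) : 0 < σ * (-1) ^ b * f.coeff (b - a) := by
  obtain ⟨c, hc, hsum⟩ := exists_pos_weights_coeff_eq hab h.strictMonoOn
  have hmem : ∀ {i}, i ∈ Finset.Icc a b → i ∈ Icc a b := fun hi => by simpa using hi
  obtain ⟨i, hi, hne⟩ : ∃ i ∈ Finset.Icc a b, f.eval (x i) ≠ 0 := by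
    by_contra! hzero
    have hinj : InjOn x (Finset.Icc a b) := by
      rw [Finset.coe_Icc]; exact h.strictMonoOn.injOn
    refine hf (eq_zero_of_degree_lt_of_eval_index_eq_zero _ hinj ?_ hzero)
    refine (degree_le_of_natDegree_le hdeg).trans_lt ?_
    rw [Nat.card_Icc]; exact_mod_cast (by lia : b - a < b + 1 - a)
  have hexpand : σ * (-1) ^ b * f.coeff (b - a) =
      ∑ i ∈ Finset.Icc a b, c i * (σ * (-1) ^ i * f.eval (x i)) := by
    rw [mul_assoc, hsum f hdeg, Finset.mul_sum]
    exact Finset.sum_congr rfl fun i _ => by ring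
  rw [hexpand]
  refine Finset.sum_pos' (fun i hi => mul_nonneg (hc i hi).le (h.nonneg i (hmem hi))) ⟨i, hi, ?_⟩
  exact mul_pos (hc i hi) ((h.nonneg i (hmem hi)).lt_of_ne' (by simp [hσ, hne]))

lemma eq_zero (h : WeaklyAlternates σ f x a b) (hσ : σ ≠ 0) (hdeg : f.natDegree < b - a) :
    f = 0 := by
  by_contra hf
  have hpos := h.coeff_pos hσ (by lia) hdeg.le hf
  rw [coeff_eq_zero_of_natDegree_lt hdeg, mul_zero] at hpos
  exact hpos.false

lemma exists_derivative (h : WeaklyAlternates σ f x a (b + 1)) :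
    ∃ y, WeaklyAlternates (-σ) (derivative f) y a b ∧
      ∀ i ∈ Icc a b, x i < y i ∧ y i < x (i + 1) := by
  have hmem : ∀ i ∈ Icc a b, i ∈ Icc a (b + 1) ∧ i + 1 ∈ Icc a (b + 1) := fun i hi =>
    ⟨⟨hi.1, hi.2.trans b.le_succ⟩, ⟨hi.1.trans i.le_succ, Nat.succ_le_succ hi.2⟩⟩
  have hslope : ∀ i ∈ Icc a b, ∃ y, (x i < y ∧ y < x (i + 1)) ∧
      0 ≤ -σ * (-1) ^ i * (derivative f).eval y := by
    intro i hi
    have hlt := h.strictMonoOn (hmem i hi).1 (hmem i hi).2 i.lt_succ_self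
    obtain ⟨y, hy, hslope⟩ := exists_hasDerivAt_eq_slope (fun t => f.eval t)
      (fun t => (derivative f).eval t) hlt f.continuousOn fun t _ => f.hasDerivAt t
    refine ⟨y, hy, ?_⟩
    have h₁ := h.nonneg i (hmem i hi).1
    have h₂ := h.nonneg (i + 1) (hmem i hi).2
    rw [pow_succ] at h₂
    rw [hslope, ← mul_div_assoc]
    exact div_nonneg (by linarith) (sub_pos.2 hlt).le
  choose! y hy hsign using hslope
  refine ⟨y, ⟨fun i hi j hj hij => ?_, hsign⟩, hy⟩
  calc y i < x (i + 1) := (hy i hi).2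
    _ ≤ x j := h.strictMonoOn.monotoneOn (hmem i hi).2 (hmem j hj).1 hij
    _ < y j := (hy j hj).1

lemma exists_derivative_derivative (h : WeaklyAlternates σ f x a (b + 2)) :
    ∃ y, WeaklyAlternates σ (derivative (derivative f)) y a b ∧
      ∀ i ∈ Icc a b, x i < y i ∧ y i < x (i + 2) := by
  obtain ⟨u, hu, hxu⟩ := h.exists_derivative
  obtain ⟨y, hy, huy⟩ := hu.exists_derivative
  refine ⟨y, by rwa [neg_neg] at hy, fun i hi => ?_⟩
  have hi' : i ∈ Icc a (b + 1) := ⟨hi.1, hi.2.trans b.le_succ⟩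
  have hi'' : i + 1 ∈ Icc a (b + 1) := ⟨hi.1.trans i.le_succ, Nat.succ_le_succ hi.2⟩
  exact ⟨(hxu i hi').1.trans (huy i hi).1, (huy i hi).2.trans (hxu _ hi'').2⟩

lemma exists_derivative_append {w : ℝ} (h : WeaklyAlternates σ f x a b) (hab : a ≤ b)
    (hw : x b < w) (hsign : 0 ≤ -σ * (-1) ^ b * (derivative f).eval w) :
    ∃ y, WeaklyAlternates (-σ) (derivative f) y a b ∧ (∀ i ∈ Icc a b, x i < y i) ∧ y b = w := by
  obtain rfl | hab := hab.eq_or_lt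
  · exact ⟨_, singleton hsign, fun i hi => by rwa [le_antisymm hi.2 hi.1], rfl⟩
  obtain ⟨b, rfl⟩ := Nat.exists_eq_succ_of_ne_zero hab.ne_bot
  obtain ⟨y, hy, hxy⟩ := h.exists_derivative
  refine ⟨_, hy.append (singleton hsign) fun _ =>
    (hxy b ⟨Nat.le_of_lt_succ hab, le_rfl⟩).2.trans hw, fun i hi => ?_, by simp⟩
  split_ifs with hib
  · exact (hxy i ⟨hi.1, hib⟩).1
  · rwa [le_antisymm hi.2 (not_le.1 hib)]

lemma eq_zero_of_derivative_derivative_eq_zero (h : WeaklyAlternates σ f x a b) (hσ : σ ≠ 0)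
    (hab : a + 2 ≤ b) (h0 : derivative (derivative f) = 0) : f = 0 := by
  obtain ⟨b, rfl⟩ := Nat.exists_eq_add_of_le' ((Nat.le_add_left 2 a).trans hab)
  obtain ⟨y, hy, -⟩ := h.exists_derivative
  have h1 : derivative f = 0 := hy.eq_zero (neg_ne_zero.2 hσ) (by rw [derivative_eq_zero.1 h0]; lia)
  exact h.eq_zero hσ (by rw [derivative_eq_zero.1 h1]; lia)

-- When `s` is odd, the shift of indices absorbs the mismatch of the signs `σ` and `τ`.
lemma exists_append {τ : ℝ} {d s : ℕ} (h₁ : WeaklyAlternates σ f x a b)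
    (h₂ : WeaklyAlternates τ f y d (c + s)) (hστ : σ = τ * (-1) ^ s) (hd : d ≤ b + 1 + s)
    (hxy : b < c → x b < y (b + 1 + s)) : ∃ u, WeaklyAlternates σ f u a c :=
  ⟨_, h₁.append (hστ ▸ (h₂.mono hd le_rfl).shift) hxy⟩

lemma exists_derivative_derivative_append {τ : ℝ} {g : ℝ[X]} {d s : ℕ}
    (h₁ : WeaklyAlternates σ f x a (b + 2))
    (h₂ : WeaklyAlternates (-τ) (derivative g) y d (c + s + 1))
    (hfg : derivative (derivative f) = derivative (derivative g)) (hab : a ≤ b)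
    (hστ : σ = τ * (-1) ^ s) (hd : d ≤ b + 1 + s) (hxy : x (b + 2) ≤ y d) :
    ∃ u, WeaklyAlternates σ (derivative (derivative f)) u a c := by
  obtain ⟨u, hu, hux⟩ := h₁.exists_derivative_derivative
  obtain ⟨v, hv, hyv⟩ := h₂.exists_derivative
  rw [neg_neg, ← hfg] at hv
  refine hu.exists_append hv hστ hd fun hbc => ?_
  calc u b < x (b + 2) := (hux b ⟨hab, le_rfl⟩).2
    _ ≤ y d := hxy
    _ ≤ y (b + 1 + s) := h₂.strictMonoOn.monotoneOn ⟨le_rfl, by lia⟩ ⟨hd, by lia⟩ hd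
    _ < v (b + 1 + s) := (hyv _ ⟨hd, by lia⟩).1

end WeaklyAlternates

lemma derivative_eq_zero_of_eval_eq_zero {f g : ℝ[X]} {x : ℕ → ℝ} {m k : ℕ}
    (hfg : derivative f = derivative g) (hdeg : (derivative f).natDegree ≤ m)
    (hx : StrictMonoOn x (Iic (m + 2))) (hf : ∀ i < k, f.eval (x i) = 0)
    (hg : ∀ i ∈ Icc k (m + 2), g.eval (x i) = 0) (hk : k ≤ m + 2) : derivative f = 0 := by
  -- A vanishing value alternates with either choice of signs.
  have halt : ∀ σ : ℝ, ∃ u, WeaklyAlternates σ (derivative f) u 0 m := by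
    intro σ
    have hf' : ∀ b < k, WeaklyAlternates (-σ) f x 0 b := fun b hb =>
      ⟨hx.mono fun i hi => hi.2.trans (hb.le.trans hk), fun i hi => by
        rw [hf i (hi.2.trans_lt hb), mul_zero]⟩
    have hg' : ∀ τ, ∀ a ≥ k, WeaklyAlternates (-τ) g x a (m + 2) := fun τ a ha =>
      ⟨hx.mono Icc_subset_Iic_self, fun i hi => by
        rw [hg i ⟨ha.trans hi.1, hi.2⟩, mul_zero]⟩
    rcases k with _ | _ | k
    · obtain ⟨v, hv, -⟩ := (hg' σ 0 le_rfl).exists_derivative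
      exact ⟨v, by rw [hfg]; exact (neg_neg σ ▸ hv).mono le_rfl (by lia)⟩
    · obtain ⟨v, hv, -⟩ := (hg' (-σ) 1 le_rfl).exists_derivative
      have hshift := WeaklyAlternates.shift (a := 0) (b := m) (k := 1) hv
      exact ⟨_, by simpa [hfg] using hshift⟩
    · obtain ⟨u, hu, hxu⟩ := (hf' (k + 1) (by lia)).exists_derivative
      obtain ⟨v, hv, hxv⟩ := (hg' (-σ) (k + 2) le_rfl).exists_derivative
      refine WeaklyAlternates.exists_append (s := 1) (neg_neg σ ▸ hu) (hfg ▸ hv) (by simp) le_rfl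
        fun hkm => ?_
      calc u k < x (k + 1) := (hxu k (by simp)).2
        _ < x (k + 2) := hx (by simp only [mem_Iic]; lia) (by simp only [mem_Iic]; lia) (by lia)
        _ < v (k + 2) := (hxv _ ⟨le_rfl, by lia⟩).1
  by_contra hne
  obtain ⟨u, hu⟩ := halt 1
  obtain ⟨v, hv⟩ := halt (-1)
  have hpos := hu.coeff_pos one_ne_zero m.zero_le hdeg hne
  have hneg := hv.coeff_pos (by simp) m.zero_le hdeg hne
  linarith

/-- The signed error of `q` as an approximation of `x ↦ |x - α|`, on the whole real line. -/
def residual (α : ℝ) (q : ℝ[X]) (x : ℝ) : ℝ := |x - α| - q.eval x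

section Residual

variable {α x : ℝ} {q : ℝ[X]} {n : ℕ}

lemma continuous_residual (α : ℝ) (q : ℝ[X]) : Continuous (residual α q) := by
  unfold residual; fun_prop

lemma residual_of_le (h : x ≤ α) : residual α q x = α - x - q.eval x := by
  rw [residual, abs_of_nonpos (sub_nonpos.2 h), neg_sub]

lemma residual_of_ge (h : α ≤ x) : residual α q x = x - α - q.eval x := by
  rw [residual, abs_of_nonneg (sub_nonneg.2 h)]

lemma residual_neg (α : ℝ) (q : ℝ[X]) (x : ℝ) :
    residual (-α) (q.comp (-X)) x = residual α q (-x) := by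
  rw [residual, residual, ← abs_neg, eval_comp, eval_neg, eval_X]
  ring_nf

lemma abs_residual_le_approxError (α : ℝ) (q : ℝ[X]) (hx : x ∈ Icc (-1 : ℝ) 1) :
    |residual α q x| ≤ approxError α q :=
  ContinuousMap.norm_coe_le_norm (checkmark α - q.toContinuousMapOn (Icc (-1 : ℝ) 1)) ⟨x, hx⟩

lemma approxError_le {E : ℝ} (h : ∀ x ∈ Icc (-1 : ℝ) 1, |residual α q x| ≤ E) :
    approxError α q ≤ E :=
  (ContinuousMap.norm_le _ ((abs_nonneg _).trans (h 0 (by norm_num)))).2 fun x => h x x.2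

lemma approxError_lt {E : ℝ} (h : ∀ x ∈ Icc (-1 : ℝ) 1, |residual α q x| < E) :
    approxError α q < E :=
  (ContinuousMap.norm_lt_iff _ ((abs_nonneg _).trans_lt (h 0 (by norm_num)))).2 fun x => h x x.2

lemma isMinimax_minimaxPoly (n : ℕ) (α : ℝ) : IsMinimax n α (minimaxPoly n α) :=
  Classical.choose_spec (exists_isMinimax n α)

lemma natDegree_minimaxPoly_le (n : ℕ) (α : ℝ) : (minimaxPoly n α).natDegree ≤ n :=
  (isMinimax_minimaxPoly n α).1

lemma minimaxError_le_approxError (hq : q.natDegree ≤ n) : minimaxError n α ≤ approxError α q :=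
  (isMinimax_minimaxPoly n α).2 q hq

lemma abs_residual_minimaxPoly_le (n : ℕ) (α : ℝ) (hx : x ∈ Icc (-1 : ℝ) 1) :
    |residual α (minimaxPoly n α) x| ≤ minimaxError n α :=
  abs_residual_le_approxError α _ hx

end Residual

/-- The residual of `q` is bounded by `E` on `[A, B]` and takes the values `± E` with alternating
signs at the nodes `z 0 < ⋯ < z m` of `[A, B]`; the sign at `z 0` is `ε`. -/
structure IsEquioscillation (m : ℕ) (α E : ℝ) (q : ℝ[X]) (A B : ℝ) (z : ℕ → ℝ) (ε : ℝ) :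
    Prop where
  abs_residual_le : ∀ x ∈ Icc A B, |residual α q x| ≤ E
  strictMonoOn : StrictMonoOn z (Iic m)
  mem_Icc : ∀ i ≤ m, z i ∈ Icc A B
  abs_sign : |ε| = 1
  sign_mul_residual : ∀ i ≤ m, ε * (-1) ^ i * residual α q (z i) = E

namespace IsEquioscillation

variable {m : ℕ} {α E A B ε : ℝ} {q : ℝ[X]} {z : ℕ → ℝ}

lemma sign_ne_zero (h : IsEquioscillation m α E q A B z ε) : ε ≠ 0 := by
  rintro rfl
  simpa using h.abs_sign

lemma abs_residual_eq {i : ℕ} (h : IsEquioscillation m α E q A B z ε) (hi : i ≤ m) :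
    |residual α q (z i)| = |E| := by
  simp [← h.sign_mul_residual i hi, abs_mul, h.abs_sign]

lemma residual_eq {i : ℕ} (h : IsEquioscillation m α E q A B z ε) (hi : i ≤ m) :
    residual α q (z i) = ε * (-1) ^ i * E := by
  have hsq : ε * ε = 1 := by rw [← abs_mul_abs_self, h.abs_sign, one_mul]
  rw [← h.sign_mul_residual i hi]
  linear_combination (-(residual α q (z i)) * ((-1) ^ i * (-1) ^ i)) * hsq
    - residual α q (z i) * neg_one_pow_mul_self i

lemma of_le {k : ℕ} (h : IsEquioscillation m α E q A B z ε) (hk : k ≤ m) :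
    IsEquioscillation k α E q A B z ε :=
  ⟨h.abs_residual_le, h.strictMonoOn.mono (Iic_subset_Iic.2 hk),
    fun i hi => h.mem_Icc i (hi.trans hk), h.abs_sign,
    fun i hi => h.sign_mul_residual i (hi.trans hk)⟩

lemma tail (h : IsEquioscillation (m + 1) α E q A B z ε) :
    IsEquioscillation m α E q A B (fun i => z (i + 1)) (-ε) := by
  refine ⟨h.abs_residual_le, fun i hi j hj hij => h.strictMonoOn ?_ ?_ (by lia),
    fun i hi => h.mem_Icc _ (by lia), by rw [abs_neg, h.abs_sign], fun i hi => ?_⟩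
  · exact Nat.succ_le_succ hi
  · exact Nat.succ_le_succ hj
  · rw [← h.sign_mul_residual (i + 1) (by lia), pow_succ]; ring

lemma of_subinterval {A' B' : ℝ} (h : IsEquioscillation m α E q A B z ε) (hA : A ≤ A')
    (hB : B' ≤ B) (hA' : A' ≤ z 0) (hB' : z m ≤ B') : IsEquioscillation m α E q A' B' z ε :=
  ⟨fun x hx => h.abs_residual_le x (Icc_subset_Icc hA hB hx), h.strictMonoOn, fun _ hi =>
    ⟨hA'.trans (h.strictMonoOn.monotoneOn m.zero_le hi (Nat.zero_le _)),
      (h.strictMonoOn.monotoneOn hi self_mem_Iic hi).trans hB'⟩, h.abs_sign, h.sign_mul_residual⟩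

lemma reflect (h : IsEquioscillation m α E q A B z ε) :
    IsEquioscillation m (-α) E (q.comp (-X)) (-B) (-A) (fun i => -z (m - i)) (ε * (-1) ^ m) := by
  refine ⟨fun x hx => ?_, fun i hi j hj hij => neg_lt_neg ?_, fun i _ => ?_, ?_, fun i hi => ?_⟩
  · rw [residual_neg]
    exact h.abs_residual_le _ ⟨le_neg.1 hx.2, neg_le.1 hx.1⟩
  · simp only [mem_Iic] at hi hj
    exact h.strictMonoOn (Nat.sub_le _ _) (Nat.sub_le _ _) (by lia)
  · have := h.mem_Icc (m - i) (Nat.sub_le _ _)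
    exact ⟨neg_le_neg this.2, neg_le_neg this.1⟩
  · simp [abs_mul, h.abs_sign]
  · rw [residual_neg, neg_neg, ← h.sign_mul_residual (m - i) (Nat.sub_le _ _), neg_one_pow_sub hi]
    ring

lemma append {u : ℝ} (h : IsEquioscillation m α E q A B z ε) (hu : z m < u) (hB : u ≤ B)
    (hres : residual α q u = -residual α q (z m)) :
    IsEquioscillation (m + 1) α E q A B (Function.update z (m + 1) u) ε := by
  have hlt : ∀ i ≤ m, z i < u := fun i hi =>
    (h.strictMonoOn.monotoneOn hi self_mem_Iic hi).trans_lt hu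
  have hz : ∀ i ≤ m, Function.update z (m + 1) u i = z i := fun i hi =>
    Function.update_of_ne (by lia) _ _
  refine ⟨h.abs_residual_le, fun i _ j hj hij => ?_, fun i hi => ?_, h.abs_sign, fun i hi => ?_⟩
  · have hj' : j ≤ m + 1 := hj
    rw [hz i (by lia)]
    rcases hj'.eq_or_lt with rfl | hj'
    · simpa using hlt i (by lia)
    · rw [hz j (by lia)]
      exact h.strictMonoOn (by simp only [mem_Iic]; lia) (by simp only [mem_Iic]; lia) hij
  · rcases hi.eq_or_lt with rfl | hi
    · simpa using ⟨(h.mem_Icc m le_rfl).1.trans hu.le, hB⟩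
    · simpa only [hz i (by lia)] using h.mem_Icc i (by lia)
  · rcases hi.eq_or_lt with rfl | hi
    · simp only [Function.update_self, hres, ← h.sign_mul_residual m le_rfl, pow_succ]
      ring
    · simpa only [hz i (by lia)] using h.sign_mul_residual i (by lia)

lemma weaklyAlternates_sub (h : IsEquioscillation m α E q A B z ε) {r : ℝ[X]}
    (hr : ∀ x ∈ Icc A B, |residual α r x| ≤ E) : WeaklyAlternates ε (r - q) z 0 m := by
  refine ⟨h.strictMonoOn.mono Icc_subset_Iic_self, fun i hi => ?_⟩
  have hle : ε * (-1) ^ i * residual α r (z i) ≤ E := by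
    refine (le_abs_self _).trans ?_
    simpa [abs_mul, h.abs_sign] using hr _ (h.mem_Icc i hi.2)
  have heq := h.sign_mul_residual i hi.2
  simp only [residual, eval_sub] at *
  linarith

lemma minimaxPoly_eq (h : IsEquioscillation (m + 1) α E q (-1) 1 z ε) (hq : q.natDegree ≤ m) :
    minimaxPoly m α = q := by
  have hle : minimaxError m α ≤ E :=
    (minimaxError_le_approxError hq).trans (approxError_le h.abs_residual_le)
  have halt := h.weaklyAlternates_sub fun x hx =>
    (abs_residual_minimaxPoly_le m α hx).trans hle
  refine sub_eq_zero.1 (halt.eq_zero h.sign_ne_zero ?_)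
  exact (natDegree_sub_le_of_le (natDegree_minimaxPoly_le m α) hq).trans_lt (by lia)

lemma minimaxError_eq (h : IsEquioscillation (m + 1) α E q (-1) 1 z ε) (hq : q.natDegree ≤ m) :
    minimaxError m α = E := by
  rw [minimaxError, h.minimaxPoly_eq hq]
  refine le_antisymm (approxError_le h.abs_residual_le) ((le_abs_self E).trans ?_)
  rw [← h.abs_residual_eq m.succ.zero_le]
  exact abs_residual_le_approxError α q (h.mem_Icc 0 m.succ.zero_le)

end IsEquioscillation

section Corner

variable {α : ℝ} {q : ℝ[X]}

lemma not_isLocalMax_residual_self (α : ℝ) (q : ℝ[X]) : ¬ IsLocalMax (residual α q) α := by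
  intro h
  have hslope : ∀ s : ℝ, |s| = 1 → (derivative q).eval α = s := by
    intro s hs
    have hmin : IsLocalMin (fun x => q.eval x - s * (x - α)) α := by
      filter_upwards [h] with x hx
      have hle : s * (x - α) ≤ |x - α| := by
        simpa [abs_mul, hs] using le_abs_self (s * (x - α))
      simp only [residual, sub_self, abs_zero] at hx
      linarith
    have hderiv := (q.hasDerivAt α).sub (((hasDerivAt_id α).sub_const α).const_mul s)
    have := hmin.hasDerivAt_eq_zero hderiv
    linarith
  linarith [hslope 1 (by simp), hslope (-1) (by simp)]

lemma residual_self_ne {E : ℝ} (hα : α ∈ Ioo (-1 : ℝ) 1)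
    (h : ∀ x ∈ Icc (-1 : ℝ) 1, |residual α q x| ≤ E) : residual α q α ≠ E := by
  rintro rfl
  refine not_isLocalMax_residual_self α q ?_
  filter_upwards [Icc_mem_nhds hα.1 hα.2] with x hx using (le_abs_self _).trans (h x hx)

lemma minimaxError_pos (n : ℕ) (hα : α ∈ Ioo (-1 : ℝ) 1) : 0 < minimaxError n α := by
  have hbound := fun x hx => abs_residual_minimaxPoly_le n α (x := x) hx
  have hαI : α ∈ Icc (-1 : ℝ) 1 := Ioo_subset_Icc_self hα
  refine lt_of_le_of_ne ((abs_nonneg _).trans (hbound α hαI)) fun h0 => ?_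
  refine residual_self_ne hα hbound ?_
  rw [← h0, ← abs_nonpos_iff]
  exact h0 ▸ hbound α hαI

lemma derivative_eval_eq_sign {E x : ℝ} (h : ∀ y ∈ Icc (-1 : ℝ) 1, |residual α q y| ≤ E)
    (hx : x ∈ Ioo (-1 : ℝ) 1) (hxα : x ≠ α) (hE : |residual α q x| = E) :
    (derivative q).eval x = SignType.sign (x - α) := by
  have hext : IsLocalExtr (residual α q) x := by
    have hnhds := Icc_mem_nhds hx.1 hx.2
    rcases abs_choice (residual α q x) with hs | hs
    · right
      filter_upwards [hnhds] with y hy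
      linarith [(abs_le.1 (h y hy)).2]
    · left
      filter_upwards [hnhds] with y hy
      linarith [(abs_le.1 (h y hy)).1]
  have hderiv := ((hasDerivAt_abs (sub_ne_zero.2 hxα)).comp_sub_const x α).sub (q.hasDerivAt x)
  linarith [hext.hasDerivAt_eq_zero hderiv]

end Corner

section Chebyshev

variable {α : ℝ} {q : ℝ[X]} {n : ℕ}

lemma exists_forall_abs_sub_mul_lt {K : Set ℝ} (hK : IsCompact K) {e r : ℝ → ℝ}
    (he : Continuous e) (hr : Continuous r) {E : ℝ} (hbound : ∀ x ∈ K, |e x| ≤ E)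
    (hpos : ∀ x ∈ K, |e x| = E → 0 < e x * r x) : ∃ t, ∀ x ∈ K, |e x - t * r x| < E := by
  have hlocal : ∀ x ∈ K, ∀ᶠ s : ℝ × ℝ in nhds (0, x),
      s.2 ∈ K → 0 < s.1 → |e s.2 - s.1 * r s.2| < E := by
    intro x hx
    rcases (hbound x hx).lt_or_eq with hlt | heq
    · have hcont : Continuous fun s : ℝ × ℝ => |e s.2 - s.1 * r s.2| := by fun_prop
      filter_upwards [hcont.continuousAt.eventually_lt (g := fun _ => E) (by fun_prop)
        (by simpa using hlt)] with s hs _ _ using hs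
    · have hcont : Continuous fun s : ℝ × ℝ => 2 * (e s.2 * r s.2) - s.1 * r s.2 ^ 2 := by fun_prop
      filter_upwards [continuousAt_const.eventually_lt hcont.continuousAt (f := fun _ => (0 : ℝ))
        (by simpa using hpos x hx heq)] with s hs hsK hs0
      refine lt_of_lt_of_le (sq_lt_sq.1 ?_) (hbound _ hsK)
      nlinarith [mul_pos hs0 hs]
  have hsmall := hK.eventually_forall_of_forall_eventually
    (P := fun t x => x ∈ K → 0 < t → |e x - t * r x| < E) hlocal
  obtain ⟨t, ht, ht0⟩ := ((hsmall.filter_mono nhdsWithin_le_nhds).and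
    (self_mem_nhdsWithin (s := Ioi (0 : ℝ)))).exists
  exact ⟨t, fun x hx => ht x hx hx ht0⟩

/-- `z 0 < ⋯ < z m` are points of `S` at which `g` alternates in sign, starting with the sign `ε`,
and `r` is a polynomial with the sign of `g` on `S` which has no sign change beyond `S`. -/
structure IsSignPattern (S : Finset ℝ) (g : ℝ → ℝ) (m : ℕ) (z : ℕ → ℝ) (ε : ℝ) (r : ℝ[X]) :
    Prop where
  strictMonoOn : StrictMonoOn z (Iic m)
  mem : ∀ i ≤ m, z i ∈ S
  abs_sign : |ε| = 1
  alternates : ∀ i ≤ m, 0 < ε * (-1) ^ i * g (z i)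
  natDegree_le : r.natDegree ≤ m
  mul_eval_pos : ∀ x ∈ S, 0 < g x * r.eval x
  eval_pos_beyond : ∀ x, (∀ s ∈ S, s ≤ x) → 0 < ε * (-1) ^ m * r.eval x

namespace IsSignPattern

variable {S : Finset ℝ} {g : ℝ → ℝ} {m : ℕ} {z : ℕ → ℝ} {ε a : ℝ} {r : ℝ[X]}

lemma singleton (ha : g a ≠ 0) :
    IsSignPattern {a} g 0 (fun _ => a) (g a / |g a|) (C (g a / |g a|)) := by
  have hpos : 0 < g a / |g a| * g a := by
    rw [div_mul_eq_mul_div]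
    exact div_pos (mul_self_pos.2 ha) (abs_pos.2 ha)
  refine ⟨fun i hi j hj hij => ?_, by simp, by simp [abs_div, ha], by simpa using hpos, by simp,
    by simpa [mul_comm] using hpos, fun x _ => ?_⟩
  · simp only [mem_Iic] at hi hj
    lia
  simp [ha]

lemma insert_of_pos (h : IsSignPattern S g m z ε r) (ha : ∀ s ∈ S, s < a)
    (hpos : 0 < ε * (-1) ^ m * g a) : IsSignPattern (insert a S) g m z ε r := by
  refine ⟨h.strictMonoOn, fun i hi => Finset.mem_insert_of_mem (h.mem i hi), h.abs_sign,
    h.alternates, h.natDegree_le, fun x hx => ?_, fun x hx => h.eval_pos_beyond x fun s hs =>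
    hx s (Finset.mem_insert_of_mem hs)⟩
  rcases Finset.mem_insert.1 hx with rfl | hx
  · have hr := h.eval_pos_beyond x fun s hs => (ha s hs).le
    refine pos_of_mul_pos_right (a := (ε * (-1) ^ m) ^ 2) ?_ (sq_nonneg _)
    linarith [mul_pos hpos hr]
  · exact h.mul_eval_pos x hx

lemma insert_of_neg (h : IsSignPattern S g m z ε r) (ha : ∀ s ∈ S, s < a)
    (hneg : ε * (-1) ^ m * g a < 0) :
    ∃ z' r', IsSignPattern (insert a S) g (m + 1) z' ε r' := by
  obtain ⟨t, htS, hta⟩ := Order.exists_between_finsets S {a} (by simpa using ha)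
  replace hta : t < a := hta a (Finset.mem_singleton_self a)
  have hz : ∀ i ≤ m, Function.update z (m + 1) a i = z i := fun i hi =>
    Function.update_of_ne (by lia) _ _
  refine ⟨Function.update z (m + 1) a, r * (C t - X), ⟨fun i _ j hj hij => ?_, fun i hi => ?_,
    h.abs_sign, fun i hi => ?_, ?_, fun x hx => ?_, fun x hx => ?_⟩⟩
  · rw [mem_Iic] at hj
    rw [hz i (by lia)]
    rcases hj.eq_or_lt with rfl | hj
    · simpa using ha _ (h.mem i (by lia))
    · rw [hz j (by lia)]
      exact h.strictMonoOn (by simp only [mem_Iic]; lia) (by simp only [mem_Iic]; lia) hij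
  · rcases hi.eq_or_lt with rfl | hi
    · simp
    · rw [hz i (by lia)]
      exact Finset.mem_insert_of_mem (h.mem i (by lia))
  · rcases hi.eq_or_lt with rfl | hi
    · rw [Function.update_self, pow_succ]
      linarith
    · rw [hz i (by lia)]
      exact h.alternates i (by lia)
  · exact natDegree_mul_le_of_le h.natDegree_le ((natDegree_sub_le _ _).trans (by simp))
  · rw [eval_mul, eval_sub, eval_C, eval_X, ← mul_assoc]
    rcases Finset.mem_insert.1 hx with rfl | hx
    · have hr := h.eval_pos_beyond x fun s hs => (ha s hs).le
      refine mul_pos_of_neg_of_neg ?_ (sub_neg.2 hta)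
      refine neg_of_mul_neg_right (a := (ε * (-1) ^ m) ^ 2) ?_ (sq_nonneg _)
      linarith [mul_neg_of_neg_of_pos hneg hr]
    · exact mul_pos (h.mul_eval_pos x hx) (sub_pos.2 (htS x hx))
  · have hr := h.eval_pos_beyond x fun s hs => hx s (Finset.mem_insert_of_mem hs)
    have hxt : 0 < x - t := sub_pos.2 (hta.trans_le (hx a (Finset.mem_insert_self a S)))
    rw [eval_mul, eval_sub, eval_C, eval_X, pow_succ]
    linarith [mul_pos hr hxt]

end IsSignPattern

lemma exists_isSignPattern {S : Finset ℝ} (hS : S.Nonempty) {g : ℝ → ℝ} (hg : ∀ x ∈ S, g x ≠ 0) :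
    ∃ m z ε r, IsSignPattern S g m z ε r := by
  induction S using Finset.induction_on_max with
  | empty => simp at hS
  | insert a S ha ih =>
    have hga : g a ≠ 0 := hg a (Finset.mem_insert_self a S)
    rcases S.eq_empty_or_nonempty with rfl | hS
    · exact ⟨_, _, _, _, IsSignPattern.singleton hga⟩
    obtain ⟨m, z, ε, r, h⟩ := ih hS fun x hx => hg x (Finset.mem_insert_of_mem hx)
    have hε : ε ≠ 0 := fun h0 => by simpa [h0] using h.abs_sign
    rcases lt_or_gt_of_ne (show ε * (-1) ^ m * g a ≠ 0 by simp [hε, hga]) with hneg | hpos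
    · obtain ⟨z', r', h'⟩ := h.insert_of_neg ha hneg
      exact ⟨_, z', _, r', h'⟩
    · exact ⟨m, z, ε, r, h.insert_of_pos ha hpos⟩

lemma eval_sub_eval_of_derivative_eq_C {c : ℝ} (h : derivative q = C c) (x y : ℝ) :
    q.eval x - q.eval y = c * (x - y) := by
  have hconst : derivative (q - C c * X) = 0 := by simp [h]
  have heq := eq_C_of_natDegree_eq_zero (derivative_eq_zero.1 hconst)
  have hx := congrArg (eval x) heq
  have hy := congrArg (eval y) heq
  simp only [eval_sub, eval_mul, eval_C, eval_X] at hx hy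
  linarith

lemma minimaxError_le_half (hn : 1 ≤ n) (hα : α ∈ Ioo (-1 : ℝ) 1) :
    minimaxError n α ≤ (1 - α ^ 2) / 2 := by
  obtain ⟨hα₁, hα₂⟩ := hα
  refine (minimaxError_le_approxError (q := C ((1 + α ^ 2) / 2) - C α * X) ?_).trans
    (approxError_le fun x hx => abs_le.2 ?_)
  · refine (natDegree_sub_le _ _).trans ?_
    simpa using (natDegree_C_mul_le α X).trans (natDegree_X_le.trans hn)
  · obtain ⟨hx₁, hx₂⟩ := hx
    rcases le_total x α with h | h
    · simp only [residual_of_le h, eval_sub, eval_C, eval_mul, eval_X]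
      constructor <;> nlinarith
    · simp only [residual_of_ge h, eval_sub, eval_C, eval_mul, eval_X]
      constructor <;> nlinarith

lemma derivative_minimaxPoly_ne_C (hn : 1 ≤ n) (hα : α ∈ Ioo (-1 : ℝ) 1) {s : ℝ} (hs : |s| = 1) :
    derivative (minimaxPoly n α) ≠ C s := by
  intro h
  have hdiff := eval_sub_eval_of_derivative_eq_C h 1 (-1)
  have hE := minimaxError_le_half hn hα
  have hright := abs_le.1 (abs_residual_minimaxPoly_le n α (x := 1) (by norm_num))
  have hleft := abs_le.1 (abs_residual_minimaxPoly_le n α (x := -1) (by norm_num))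
  obtain ⟨hα₁, hα₂⟩ := hα
  rw [residual_of_ge hα₂.le] at hright
  rw [residual_of_le hα₁.le] at hleft
  rcases (abs_eq zero_le_one).1 hs with rfl | rfl <;> nlinarith

lemma finite_setOf_abs_residual_eq (h₁ : derivative q ≠ 1) (h₂ : derivative q ≠ -1) (E : ℝ) :
    {x | |residual α q x| = E}.Finite := by
  have hroots : ∀ r : ℝ[X], derivative r ≠ 0 → ∀ c, {x | r.eval x = c}.Finite := by
    intro r hr c
    have hne : r - C c ≠ 0 := fun h0 => hr (by simp [sub_eq_zero.1 h0])
    refine (finite_setOfPred_isRoot hne).subset fun x hx => ?_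
    simpa [IsRoot, sub_eq_zero] using hx
  have hL := hroots (C α - X - q) (by simpa [sub_eq_zero, eq_comm (a := (-1 : ℝ[X]))] using h₂)
  have hR := hroots (X - C α - q) (by simpa [sub_eq_zero, eq_comm (a := (1 : ℝ[X]))] using h₁)
  refine ((hL E).union (hL (-E))).union ((hR E).union (hR (-E))) |>.subset fun x hx => ?_
  have hx : |residual α q x| = E := hx
  have hE : residual α q x = E ∨ residual α q x = -E := (abs_eq (hx ▸ abs_nonneg _)).1 hx
  rcases le_total x α with h | h
  · left; simpa [residual_of_le h] using hE
  · right; simpa [residual_of_ge h] using hE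

-- If the alternation were shorter, subtracting a small multiple of a polynomial with the sign of
-- the residual at its extremal points would decrease the error.
theorem exists_isEquioscillation_minimaxPoly (hn : 1 ≤ n) (hα : α ∈ Ioo (-1 : ℝ) 1) :
    ∃ z ε, IsEquioscillation (n + 1) α (minimaxError n α) (minimaxPoly n α) (-1) 1 z ε := by
  have hbound := fun x hx => abs_residual_minimaxPoly_le n α (x := x) hx
  have hE := minimaxError_pos n hα
  have hfin := (finite_setOf_abs_residual_eq (α := α)
    (by simpa using derivative_minimaxPoly_ne_C hn hα (s := 1) (by simp))
    (by simpa using derivative_minimaxPoly_ne_C hn hα (s := -1) (by simp))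
    (minimaxError n α)).inter_of_right (Icc (-1) 1)
  have hnot : ∀ r : ℝ[X], r.natDegree ≤ n →
      ¬ ∀ x ∈ hfin.toFinset, 0 < residual α (minimaxPoly n α) x * r.eval x := by
    intro r hr hpos
    obtain ⟨t, ht⟩ := exists_forall_abs_sub_mul_lt isCompact_Icc (continuous_residual α _)
      r.continuous hbound fun x hx hxE => hpos x (hfin.mem_toFinset.2 ⟨hx, hxE⟩)
    have hlt : approxError α (minimaxPoly n α + C t * r) < minimaxError n α :=
      approxError_lt fun x hx => by simpa [residual, sub_sub] using ht x hx
    refine hlt.not_ge (minimaxError_le_approxError ?_)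
    exact natDegree_add_le_of_degree_le (natDegree_minimaxPoly_le n α)
      ((natDegree_C_mul_le _ _).trans hr)
  have hne : hfin.toFinset.Nonempty := by
    by_contra hempty
    exact hnot 0 (by simp) (by simp [Finset.not_nonempty_iff_eq_empty.1 hempty])
  obtain ⟨m, z, ε, r, h⟩ := exists_isSignPattern hne (g := residual α (minimaxPoly n α))
    fun x hx h0 => by simpa [h0, hE.ne] using (hfin.mem_toFinset.1 hx).2
  have hm : n + 1 ≤ m := not_lt.1 fun hlt =>
    hnot r (h.natDegree_le.trans (Nat.le_of_lt_succ hlt)) h.mul_eval_pos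
  have hz := fun i hi => hfin.mem_toFinset.1 (h.mem i hi)
  refine ⟨z, ε, IsEquioscillation.of_le ⟨hbound, h.strictMonoOn, fun i hi => (hz i hi).1,
    h.abs_sign, fun i hi => ?_⟩ hm⟩
  rw [← (hz i hi).2.out, ← abs_of_pos (h.alternates i hi)]
  simp [abs_mul, h.abs_sign]

end Chebyshev

section Reflection

variable {n : ℕ} {α w : ℝ}

lemma approxError_neg_le (α : ℝ) (q : ℝ[X]) : approxError (-α) (q.comp (-X)) ≤ approxError α q :=
  approxError_le fun x hx => by
    rw [residual_neg]
    exact abs_residual_le_approxError α q ⟨neg_le_neg hx.2, neg_le.1 hx.1⟩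

lemma minimaxError_neg (n : ℕ) (α : ℝ) : minimaxError n (-α) = minimaxError n α := by
  have hle : ∀ β, minimaxError n (-β) ≤ minimaxError n β := fun β => by
    refine (minimaxError_le_approxError ?_).trans (approxError_neg_le β (minimaxPoly n β))
    exact (natDegree_comp_le.trans (by simp)).trans (natDegree_minimaxPoly_le n β)
  exact (hle α).antisymm (by simpa using hle (-α))

lemma minimaxPoly_neg (hn : 1 ≤ n) (hα : α ∈ Ioo (-1 : ℝ) 1) :
    minimaxPoly n (-α) = (minimaxPoly n α).comp (-X) := by
  obtain ⟨z, ε, h⟩ := exists_isEquioscillation_minimaxPoly hn hα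
  have hrefl := h.reflect
  rw [neg_neg] at hrefl
  refine hrefl.minimaxPoly_eq ?_
  exact (natDegree_comp_le.trans (by simp)).trans (natDegree_minimaxPoly_le n α)

lemma coeff_minimaxPoly_neg (hn : 1 ≤ n) (hα : α ∈ Ioo (-1 : ℝ) 1) :
    (minimaxPoly n (-α)).coeff n = (-1) ^ n * (minimaxPoly n α).coeff n := by
  have hX : (-X : ℝ[X]) = C (-1) * X := by simp
  rw [minimaxPoly_neg hn hα, hX, comp_C_mul_X_coeff, mul_comm]

lemma normalizedError_neg (hn : 1 ≤ n) (hα : α ∈ Ioo (-1 : ℝ) 1) (x : ℝ) :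
    normalizedError n (-α) x = normalizedError n α (-x) := by
  rw [normalizedError, normalizedError, minimaxError_neg, minimaxPoly_neg hn hα, ← abs_neg,
    eval_comp, eval_neg, eval_X]
  ring_nf

lemma isOutsideCritical_neg (hn : 1 ≤ n) (hα : α ∈ Ioo (-1 : ℝ) 1)
    (h : IsOutsideCritical n α w) : IsOutsideCritical n (-α) (-w) := by
  refine ⟨fun hw => h.1 ⟨by linarith [hw.2], by linarith [hw.1]⟩, ?_⟩
  have hderiv : HasDerivAt (normalizedError n α) 0 (-(-w)) := (neg_neg w).symm ▸ h.2
  have hcomp := hderiv.comp (-w) (hasDerivAt_neg (-w))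
  rw [zero_mul] at hcomp
  rw [funext (normalizedError_neg hn hα)]
  exact hcomp

lemma isOutsideCritical_iff_of_one_lt (hα : α ∈ Ioo (-1 : ℝ) 1) (hw : 1 < w) :
    IsOutsideCritical n α w ↔ (derivative (minimaxPoly n α)).eval w = 1 := by
  have hwα : 0 < w - α := by linarith [hα.2]
  have hderiv := (((minimaxPoly n α).hasDerivAt w).sub
    ((hasDerivAt_abs hwα.ne').comp_sub_const w α)).div_const (minimaxError n α)
  rw [sign_pos hwα, SignType.coe_one] at hderiv
  have hE := (minimaxError_pos n hα).ne'
  refine ⟨fun h => ?_, fun h => ⟨fun hmem => hw.not_ge hmem.2, ?_⟩⟩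
  · have := hderiv.unique h.2
    simpa [hE, sub_eq_zero] using this
  · rw [h, sub_self, zero_div] at hderiv
    exact hderiv

lemma one_lt_or_one_lt_neg_of_isOutsideCritical (h : IsOutsideCritical n α w) :
    1 < w ∨ 1 < -w := by
  by_contra! hw
  exact h.1 ⟨neg_le.1 hw.2, hw.1⟩

lemma inVShape_neg (h : InVShape n α) : InVShape n (-α) := by
  obtain ⟨a, b, c, ⟨ha, hab, hbc, hc, ⟨μ, hμ, hleft⟩, ⟨ν, hν, hright⟩⟩, hα⟩ := h
  refine ⟨-c, -b, -a, ⟨neg_lt_neg hc, neg_lt_neg hbc, neg_lt_neg hab, neg_lt.1 ha,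
    ⟨-ν, neg_neg_of_pos hν, fun x hx => ?_⟩, ⟨-μ, neg_pos.2 hμ, fun x hx => ?_⟩⟩,
    ⟨neg_le_neg hα.2, neg_le_neg hα.1⟩⟩
  · rw [minimaxError_neg, ← minimaxError_neg, hright (-x) ⟨le_neg.1 hx.2, neg_le.1 hx.1⟩]
    ring
  · rw [minimaxError_neg, ← minimaxError_neg, hleft (-x) ⟨le_neg.1 hx.2, neg_le.1 hx.1⟩]
    ring

end Reflection

lemma exists_isEquioscillation_of_mem_alternationSet {n : ℕ} {α x : ℝ}
    (hx : x ∈ alternationSet n α) :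
    ∃ M z ε, n + 1 ≤ M ∧
      IsEquioscillation M α (minimaxError n α) (minimaxPoly n α) (-1) 1 z ε ∧ ∃ i ≤ M, z i = x := by
  obtain ⟨N, hN, s, hs, hmem, ⟨ε, hε, halt⟩, ⟨k, hk⟩⟩ := hx
  obtain ⟨M, rfl⟩ : ∃ M, N = M + 1 := ⟨N - 1, by lia⟩
  have hε' : |ε| = 1 := (abs_eq zero_le_one).2 hε
  have hεε : ε * ε = 1 := by rw [← abs_mul_abs_self, hε', one_mul]
  refine ⟨M, fun i => s (Fin.ofNat (M + 1) i), ε, by lia,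
    ⟨fun y hy => abs_residual_minimaxPoly_le n α hy, fun i hi j hj hij => hs ?_,
    fun i _ => hmem _, hε', fun i hi => ?_⟩, k, by lia, by simpa using hk⟩
  · rw [mem_Iic] at hi hj
    rw [Fin.lt_def, Fin.val_ofNat, Fin.val_ofNat, Nat.mod_eq_of_lt, Nat.mod_eq_of_lt] <;> lia
  · rw [residual, halt, Fin.val_ofNat, Nat.mod_eq_of_lt (by lia)]
    linear_combination minimaxError n α * ((-1) ^ i * (-1) ^ i) * hεε
      + minimaxError n α * neg_one_pow_mul_self i

/-- The affine map carrying the interval `[A, B]` to `[-1, 1]`. -/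
noncomputable def rescale (A B x : ℝ) : ℝ := (2 * x - A - B) / (B - A)

section Rescale

variable {A B x y : ℝ}

lemma rescale_neg (A B x : ℝ) : rescale (-B) (-A) (-x) = -rescale A B x := by
  rw [rescale, rescale, ← neg_div]
  ring_nf

lemma rescale_neg_one_one (x : ℝ) : rescale (-1) 1 x = x := by
  rw [rescale]; ring

lemma rescale_add_one (hAB : A < B) (x : ℝ) : rescale A B x + 1 = 2 * (x - A) / (B - A) := by
  have : B - A ≠ 0 := (sub_pos.2 hAB).ne'
  rw [rescale]; field_simp; ring

lemma rescale_sub_rescale (A B x y : ℝ) :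
    rescale A B x - rescale A B y = 2 / (B - A) * (x - y) := by
  rw [rescale, rescale]; ring

lemma strictMono_rescale (hAB : A < B) : StrictMono (rescale A B) := fun x y hxy => by
  have : 0 < B - A := sub_pos.2 hAB
  rw [rescale, rescale]
  gcongr

lemma rescale_mem_Icc (hAB : A < B) (hx : x ∈ Icc A B) : rescale A B x ∈ Icc (-1 : ℝ) 1 := by
  have : 0 < B - A := sub_pos.2 hAB
  rw [rescale]
  exact ⟨(le_div_iff₀ this).2 (by linarith [hx.1]), (div_le_iff₀ this).2 (by linarith [hx.2])⟩

lemma exists_rescale_eq (hAB : A < B) (hy : y ∈ Icc (-1 : ℝ) 1) :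
    ∃ x ∈ Icc A B, rescale A B x = y := by
  have : 0 < B - A := sub_pos.2 hAB
  refine ⟨((B - A) * y + (A + B)) / 2, ⟨by nlinarith [hy.1], by nlinarith [hy.2]⟩, ?_⟩
  rw [rescale]; field_simp; ring

lemma rescale_lt_rescale_of_lt_right {t : ℝ} (hx : A < x) (ht : A < t) (htB : t < B) :
    rescale A B x < rescale A t x := by
  rw [← add_lt_add_iff_right 1, rescale_add_one ht, rescale_add_one (ht.trans htB)]
  have : 0 < x - A := sub_pos.2 hx
  have : 0 < t - A := sub_pos.2 ht
  gcongr

lemma rescale_lt_rescale_of_lt_left {s : ℝ} (hx : x < B) (hs : s < B) (hAs : A < s) :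
    rescale s B x < rescale A B x := by
  rw [← neg_lt_neg_iff, ← rescale_neg, ← rescale_neg]
  exact rescale_lt_rescale_of_lt_right (neg_lt_neg hx) (neg_lt_neg hs) (neg_lt_neg hAs)

end Rescale

namespace IsEquioscillation

variable {m : ℕ} {α E A B ε : ℝ} {q : ℝ[X]} {z : ℕ → ℝ}

lemma image_rescale (h : IsEquioscillation m α E q A B z ε) (hAB : A < B) :
    IsEquioscillation m (rescale A B α) (2 / (B - A) * E)
      (C (2 / (B - A)) * q.comp (C ((B - A) / 2) * X + C ((A + B) / 2))) (-1) 1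
      (fun i => rescale A B (z i)) ε := by
  have hc : 0 < 2 / (B - A) := div_pos two_pos (sub_pos.2 hAB)
  have hinv : ∀ x, (B - A) / 2 * rescale A B x + (A + B) / 2 = x := fun x => by
    have : B - A ≠ 0 := (sub_pos.2 hAB).ne'
    rw [rescale]; field_simp; ring
  have hres : ∀ x, residual (rescale A B α)
      (C (2 / (B - A)) * q.comp (C ((B - A) / 2) * X + C ((A + B) / 2)))
      (rescale A B x) = 2 / (B - A) * residual α q x := fun x => by
    rw [residual, rescale_sub_rescale, abs_mul, abs_of_pos hc, eval_mul, eval_comp, eval_add,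
      eval_mul, eval_C, eval_C, eval_C, eval_X, hinv, residual, mul_sub]
  refine ⟨fun y hy => ?_, (strictMono_rescale hAB).comp_strictMonoOn h.strictMonoOn,
    fun i hi => rescale_mem_Icc hAB (h.mem_Icc i hi), h.abs_sign, fun i hi => ?_⟩
  · obtain ⟨x, hx, rfl⟩ := exists_rescale_eq hAB hy
    rw [hres, abs_mul, abs_of_pos hc]
    exact mul_le_mul_of_nonneg_left (h.abs_residual_le x hx) hc.le
  · rw [hres, ← h.sign_mul_residual i hi]
    ring

lemma minimaxError_rescale (h : IsEquioscillation (m + 1) α E q A B z ε) (hq : q.natDegree ≤ m)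
    (hAB : A < B) : minimaxError m (rescale A B α) = 2 / (B - A) * E := by
  refine (h.image_rescale hAB).minimaxError_eq ((natDegree_C_mul_le _ _).trans ?_)
  rw [natDegree_comp]
  exact (Nat.mul_le_mul hq natDegree_linear_le).trans_eq (mul_one m)

lemma minimaxError_eq_mul_add_one {t x : ℝ} (h : IsEquioscillation (m + 1) α E q A B z ε)
    (hq : q.natDegree ≤ m) (hα : A < α) (ht : A < t) (htB : t ≤ B) (hzt : z (m + 1) ≤ t)
    (hx : x ∈ Icc (rescale A B α) (rescale A t α)) :
    minimaxError m x = E / (α - A) * (x + 1) := by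
  have hcont : ContinuousOn (fun u => rescale A u α) (Icc t B) :=
    ContinuousOn.div (by fun_prop) (by fun_prop) fun u hu => by linarith [hu.1]
  obtain ⟨u, hu, rfl⟩ := intermediate_value_Icc' htB hcont hx
  have hAu : A < u := ht.trans_le hu.1
  have hosc := h.of_subinterval le_rfl hu.2 (h.mem_Icc 0 (Nat.zero_le _)).1 (hzt.trans hu.1)
  rw [hosc.minimaxError_rescale hq hAu, rescale_add_one hAu]
  have : u - A ≠ 0 := (sub_pos.2 hAu).ne'
  have : α - A ≠ 0 := (sub_pos.2 hα).ne'
  field_simp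

lemma minimaxError_eq_mul_one_sub {s x : ℝ} (h : IsEquioscillation (m + 1) α E q A B z ε)
    (hq : q.natDegree ≤ m) (hα : α < B) (hs : s < B) (hAs : A ≤ s) (hsz : s ≤ z 0)
    (hx : x ∈ Icc (rescale s B α) (rescale A B α)) :
    minimaxError m x = E / (B - α) * (1 - x) := by
  have hrefl := h.reflect.minimaxError_eq_mul_add_one (t := -s) (x := -x)
    (by simpa [natDegree_comp] using hq) (neg_lt_neg hα) (neg_lt_neg hs) (neg_le_neg hAs)
    (by simpa using hsz)
    (by rw [rescale_neg, rescale_neg]; exact ⟨neg_le_neg hx.2, neg_le_neg hx.1⟩)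
  rw [← minimaxError_neg, hrefl]
  ring

-- An alternation with `m + 3` nodes has one node to spare: shrinking the interval at either end
-- keeps the `m + 2` nodes that determine `E_m`, and only rescales the problem.
lemma isVShape {s t : ℝ} (h : IsEquioscillation (m + 2) α E q A B z ε) (hq : q.natDegree ≤ m)
    (hE : 0 < E) (hAs : A < s) (hs : s < α) (hsz : s ≤ z 1) (ht : α < t) (htB : t < B)
    (hzt : z (m + 1) ≤ t) :
    IsVShape m (rescale s B α) (rescale A B α) (rescale A t α) := by
  have hA : A < α := hAs.trans hs
  have hB : α < B := ht.trans htB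
  have hright := fun x hx => (h.of_le (m + 1).le_succ).minimaxError_eq_mul_add_one (x := x) hq hA
    (hA.trans ht) htB.le hzt hx
  have hleft := fun x hx => h.tail.minimaxError_eq_mul_one_sub (x := x) hq hB (hs.trans hB)
    hAs.le hsz hx
  have hlt₁ := rescale_lt_rescale_of_lt_left hB (hs.trans hB) hAs
  have hlt₂ := rescale_lt_rescale_of_lt_right hA (hA.trans ht) htB
  refine ⟨?_, hlt₁, hlt₂, ?_, ⟨-(E / (B - α)), ?_, fun x hx => ?_⟩,
    ⟨E / (α - A), ?_, fun x hx => ?_⟩⟩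
  · rw [neg_lt_iff_pos_add, rescale_add_one (hs.trans hB)]
    exact div_pos (by linarith) (by linarith)
  · rw [← neg_lt_neg_iff, ← rescale_neg, neg_lt_iff_pos_add, rescale_add_one (by linarith)]
    exact div_pos (by linarith) (by linarith)
  · exact neg_neg_of_pos (div_pos hE (sub_pos.2 hB))
  · rw [hleft x hx, hleft _ (right_mem_Icc.2 hlt₁.le)]; ring
  · exact div_pos hE (sub_pos.2 hA)
  · rw [hright x hx, hright _ (left_mem_Icc.2 hlt₂.le)]; ring

lemma lt_node_one (h : IsEquioscillation (m + 1) α E q A B z ε) : A < z 1 :=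
  (h.mem_Icc 0 (Nat.zero_le _)).1.trans_lt
    (h.strictMonoOn (Nat.zero_le _) (Nat.le_add_left 1 m) one_pos)

lemma node_lt (h : IsEquioscillation (m + 1) α E q A B z ε) : z m < B :=
  (h.strictMonoOn m.le_succ self_mem_Iic m.lt_succ_self).trans_le (h.mem_Icc _ le_rfl).2

lemma isVShapeTip (h : IsEquioscillation (m + 2) α E q (-1) 1 z ε) (hq : q.natDegree ≤ m)
    (hE : 0 < E) (hα : α ∈ Ioo (-1 : ℝ) 1) : IsVShapeTip m α := by
  obtain ⟨s, hs, hs'⟩ := exists_between (lt_min hα.1 h.lt_node_one)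
  obtain ⟨t, ht, ht'⟩ := exists_between (max_lt hα.2 h.node_lt)
  rw [lt_min_iff] at hs'
  rw [max_lt_iff] at ht
  refine ⟨rescale s 1 α, rescale (-1) t α, ?_⟩
  simpa only [rescale_neg_one_one] using h.isVShape hq hE hs hs'.1 hs'.2.le ht.1 ht' ht.2.le

end IsEquioscillation

lemma inVShape_of_isVShapeTip {n : ℕ} {α : ℝ} (h : IsVShapeTip n α) : InVShape n α := by
  obtain ⟨a, c, hV⟩ := h
  exact ⟨a, α, c, hV, hV.2.1.le, hV.2.2.1.le⟩

section Prolongation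

variable {m n : ℕ} {α E A B ε : ℝ} {q : ℝ[X]} {z : ℕ → ℝ}

lemma strictAntiOn_Ici_of_derivative_ne_zero {ψ : ℝ[X]} {a : ℝ}
    (hlim : Filter.Tendsto (fun x => ψ.eval x) Filter.atTop Filter.atBot)
    (hψ : ∀ x > a, (derivative ψ).eval x ≠ 0) : StrictAntiOn (fun x => ψ.eval x) (Ici a) := by
  rcases hasDerivWithinAt_forall_lt_or_forall_gt_of_forall_ne (convex_Ioi a)
    (fun x _ => ψ.hasDerivWithinAt x (Ioi a)) hψ with hneg | hpos
  · refine strictAntiOn_of_deriv_neg (convex_Ici a) ψ.continuousOn fun x hx => ?_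
    rw [interior_Ici] at hx
    exact ψ.deriv.trans_lt (hneg x hx)
  · have hmono : StrictMonoOn (fun x => ψ.eval x) (Ici a) := by
      refine strictMonoOn_of_deriv_pos (convex_Ici a) ψ.continuousOn fun x hx => ?_
      rw [interior_Ici] at hx
      exact (hpos x hx).trans_eq ψ.deriv.symm
    obtain ⟨y, hy, hay⟩ := ((hlim.eventually (Filter.eventually_lt_atBot (ψ.eval a))).and
      (Filter.eventually_ge_atTop a)).exists
    exact absurd (hmono.monotoneOn self_mem_Ici hay hay) hy.not_ge

namespace IsEquioscillation

lemma exists_last_eq (h : IsEquioscillation (m + 1) α E q A B z ε) (hB : |residual α q B| = |E|) :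
    (∃ z', IsEquioscillation (m + 2) α E q A B z' ε) ∨
      ∃ z', IsEquioscillation (m + 1) α E q A B z' ε ∧ z' 0 = z 0 ∧ z' (m + 1) = B := by
  by_cases heq : residual α q B = residual α q (z (m + 1))
  · have hneg : residual α q B = -residual α q (z m) := by
      rw [heq, h.residual_eq le_rfl, h.residual_eq m.le_succ, pow_succ]
      ring
    exact .inr ⟨_, (h.of_le m.le_succ).append h.node_lt le_rfl hneg, by simp, by simp⟩
  · have hneg : residual α q B = -residual α q (z (m + 1)) :=
      (abs_eq_abs.1 (hB.trans (h.abs_residual_eq le_rfl).symm)).resolve_left heq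
    have hlt : z (m + 1) < B := lt_of_le_of_ne (h.mem_Icc _ le_rfl).2 fun h' => heq (by rw [h'])
    exact .inl ⟨_, h.append hlt le_rfl hneg⟩

lemma exists_append_beyond (h : IsEquioscillation m α E q A B z ε) (hz : z m = B) (hαB : α ≤ B)
    (hE : 0 < E) (hcrit : ∀ x > B, (derivative q).eval x ≠ 1)
    (hlim : Filter.Tendsto (fun x => ε * (-1) ^ m * (x - α - q.eval x)) Filter.atTop
      Filter.atBot) :
    ∃ u > B, IsEquioscillation (m + 1) α E q A u (Function.update z (m + 1) u) ε := by
  set ψ : ℝ[X] := C (ε * (-1) ^ m) * (X - C α - q) with hψ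
  have hψ_eval : ∀ x ≥ B, ψ.eval x = ε * (-1) ^ m * residual α q x := fun x hx => by
    rw [residual_of_ge (hαB.trans hx)]; simp [hψ]
  have hψ_anti : StrictAntiOn (fun x => ψ.eval x) (Ici B) := by
    refine strictAntiOn_Ici_of_derivative_ne_zero (by simpa [hψ] using hlim) fun x hx => ?_
    rw [hψ, derivative_C_mul, eval_mul, eval_C]
    refine mul_ne_zero (by simp [h.sign_ne_zero]) ?_
    simpa [sub_eq_zero] using (hcrit x hx).symm
  have hψB : ψ.eval B = E := by
    rw [hψ_eval B le_rfl, ← h.sign_mul_residual m le_rfl, hz]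
  obtain ⟨u, hBu, hu⟩ : ∃ u > B, ψ.eval u = -E := by
    obtain ⟨y, hy, hBy⟩ := ((hlim.eventually (Filter.eventually_lt_atBot (-E))).and
      (Filter.eventually_ge_atTop B)).exists
    obtain ⟨u, hu, huE⟩ := intermediate_value_Icc' hBy ψ.continuousOn
      (show -E ∈ Icc (ψ.eval y) (ψ.eval B) from ⟨by simpa [hψ] using hy.le, by linarith⟩)
    refine ⟨u, lt_of_le_of_ne hu.1 ?_, huE⟩
    rintro rfl
    linarith [hψB.symm.trans huE]
  have hbound : ∀ x ∈ Icc A u, |residual α q x| ≤ E := by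
    intro x hx
    rcases le_total x B with hxB | hBx
    · exact h.abs_residual_le x ⟨hx.1, hxB⟩
    · have habs : |ψ.eval x| = |residual α q x| := by
        simp [hψ_eval x hBx, abs_mul, h.abs_sign]
      rw [← habs, abs_le]
      exact ⟨hu ▸ hψ_anti.antitoneOn hBx hBu.le hx.2, hψB ▸ hψ_anti.antitoneOn self_mem_Ici hBx hBx⟩
  have hosc : IsEquioscillation m α E q A u z ε :=
    ⟨hbound, h.strictMonoOn, fun i hi => Icc_subset_Icc_right hBu.le (h.mem_Icc i hi), h.abs_sign,
      h.sign_mul_residual⟩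
  refine ⟨u, hBu, hosc.append (hz ▸ hBu) le_rfl ?_⟩
  refine mul_left_cancel₀ (a := ε * (-1) ^ m) (by simp [h.sign_ne_zero]) ?_
  rw [mul_neg, h.sign_mul_residual m le_rfl, ← hψ_eval u hBu.le, hu]

end IsEquioscillation

lemma tendsto_atBot_mul_sub_eval {σ : ℝ} (hn : 2 ≤ n) (hq : q.natDegree ≤ n)
    (hc : 0 < σ * q.coeff n) (α : ℝ) :
    Filter.Tendsto (fun x => σ * (x - α - q.eval x)) Filter.atTop Filter.atBot := by
  have hcoeff : (C σ * (X - C α - q)).coeff n = -(σ * q.coeff n) := by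
    have h₁ : (X : ℝ[X]).coeff n = 0 := coeff_X_of_ne_one (by lia)
    have h₀ : (C α).coeff n = 0 := coeff_C_of_ne_zero (by lia)
    simp [h₁, h₀]
  have hdeg : (C σ * (X - C α - q)).natDegree = n := by
    have hX : (X - C α).natDegree ≤ n := by
      rw [natDegree_X_sub_C]
      lia
    refine natDegree_eq_of_le_of_coeff_ne_zero ((natDegree_C_mul_le _ _).trans
      ((natDegree_sub_le_of_le hX hq).trans_eq (max_self n))) ?_
    rw [hcoeff]
    linarith
  have hlim := (C σ * (X - C α - q)).tendsto_atBot_of_leadingCoeff_nonpos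
    (natDegree_pos_iff_degree_pos.1 (by lia)) (by rw [leadingCoeff, hdeg, hcoeff]; linarith)
  simpa only [eval_mul, eval_C, eval_sub, eval_X] using hlim

-- Without a critical point beyond `1`, the error curve can be followed to the right of `1` until
-- it reaches its next alternation value at some `u`; on `[-1, u]` there is one node to spare.
lemma exists_isOutsideCritical_or_inVShape (hn : 2 ≤ n) (hα : α ∈ Ioo (-1 : ℝ) 1)
    (h : IsEquioscillation (n + 1) α (minimaxError n α) (minimaxPoly n α) (-1) 1 z ε)
    (hz : z (n + 1) = 1) (hc : 0 < ε * (-1) ^ (n + 1) * (minimaxPoly n α).coeff n) :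
    (∃ w, IsOutsideCritical n α w) ∨ InVShape n α := by
  by_cases hw : ∃ w > 1, (derivative (minimaxPoly n α)).eval w = 1
  · obtain ⟨w, hw, hw'⟩ := hw
    exact .inl ⟨w, (isOutsideCritical_iff_of_one_lt hα hw).2 hw'⟩
  push Not at hw
  have hE := minimaxError_pos n hα
  have hdeg := natDegree_minimaxPoly_le n α
  obtain ⟨u, hu, hosc⟩ := h.exists_append_beyond hz hα.2.le hE hw
    (tendsto_atBot_mul_sub_eval hn hdeg hc α)
  obtain ⟨s, hs, hs'⟩ := exists_between (lt_min hα.1 hosc.lt_node_one)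
  rw [lt_min_iff] at hs'
  have hV := hosc.isVShape hdeg hE hs hs'.1 hs'.2.le hα.2 hu (by simp [hz])
  rw [rescale_neg_one_one] at hV
  exact .inr ⟨_, _, _, hV, (hV.2.1.trans hV.2.2.1).le, le_rfl⟩

lemma exists_isEquioscillation_endpoints (hα : α ∈ Ioo (-1 : ℝ) 1)
    (hA : {-1, 1} ⊆ alternationSet n α) (hV : ¬ InVShape n α) :
    ∃ z ε, IsEquioscillation (n + 1) α (minimaxError n α) (minimaxPoly n α) (-1) 1 z ε ∧
      z 0 = -1 ∧ z (n + 1) = 1 := by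
  have hlong : ∀ z ε,
      ¬ IsEquioscillation (n + 2) α (minimaxError n α) (minimaxPoly n α) (-1) 1 z ε := fun z ε h =>
    hV (inVShape_of_isVShapeTip
      (h.isVShapeTip (natDegree_minimaxPoly_le n α) (minimaxError_pos n hα) hα))
  obtain ⟨M, z, ε, hM, h, i, hi, hzi⟩ :=
    exists_isEquioscillation_of_mem_alternationSet (hA (mem_insert _ _))
  obtain ⟨M', z', ε', -, h', i', hi', hzi'⟩ :=
    exists_isEquioscillation_of_mem_alternationSet (hA (mem_insert_of_mem _ rfl))
  have hz0 : z 0 = -1 := (hzi ▸ h.strictMonoOn.monotoneOn M.zero_le hi i.zero_le).antisymm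
    (h.mem_Icc 0 M.zero_le).1
  rcases (h.of_le hM).exists_last_eq (hzi' ▸ h'.abs_residual_eq hi') with
    ⟨y, hy⟩ | ⟨y, hy, hy0, hy1⟩
  · exact absurd hy (hlong y ε)
  · exact ⟨y, ε, hy, hy0.trans hz0, hy1⟩

theorem exists_isOutsideCritical (hn : 2 ≤ n) (hα : α ∈ Ioo (-1 : ℝ) 1)
    (hA : {-1, 1} ⊆ alternationSet n α) (htip : ¬ IsVShapeTip (n - 1) α) (hV : ¬ InVShape n α) :
    ∃ w, IsOutsideCritical n α w := by
  obtain ⟨z, ε, h, hz0, hz1⟩ := exists_isEquioscillation_endpoints hα hA hV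
  have hn1 : 1 ≤ n := one_le_two.trans hn
  rcases lt_trichotomy (ε * (-1) ^ (n + 1) * (minimaxPoly n α).coeff n) 0 with hc | hc | hc
  · have hα' : -α ∈ Ioo (-1 : ℝ) 1 := ⟨neg_lt_neg hα.2, neg_lt.1 hα.1⟩
    have hrefl := h.reflect
    rw [neg_neg, ← minimaxPoly_neg hn1 hα, ← minimaxError_neg] at hrefl
    rcases exists_isOutsideCritical_or_inVShape hn hα' hrefl (by simp [hz0]) (by
      rw [mul_assoc ε, neg_one_pow_mul_self, coeff_minimaxPoly_neg hn1 hα]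
      rw [pow_succ] at hc
      linarith) with ⟨w, hw⟩ | hV'
    · exact ⟨-w, neg_neg α ▸ isOutsideCritical_neg hn1 hα' hw⟩
    · exact absurd (neg_neg α ▸ inVShape_neg hV') hV
  · obtain ⟨k, rfl⟩ := Nat.exists_eq_succ_of_ne_zero (by lia : n ≠ 0)
    have hc0 : (minimaxPoly (k + 1) α).coeff (k + 1) = 0 := by simpa [h.sign_ne_zero] using hc
    refine absurd (h.isVShapeTip ?_ (minimaxError_pos _ hα) hα) htip
    have := natDegree_minimaxPoly_le (k + 1) α
    exact natDegree_le_pred this hc0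
  · exact (exists_isOutsideCritical_or_inVShape hn hα h hz1 hc).resolve_right hV

end Prolongation

section CornerNode

variable {m n : ℕ} {α E w ε : ℝ} {q : ℝ[X]} {z : ℕ → ℝ}

lemma natDegree_derivative_derivative_minimaxPoly_le (n : ℕ) (α : ℝ) :
    (derivative (derivative (minimaxPoly n α))).natDegree ≤ n - 2 := by
  have h₁ := natDegree_derivative_le (minimaxPoly n α)
  have h₂ := natDegree_derivative_le (derivative (minimaxPoly n α))
  have h₃ := natDegree_minimaxPoly_le n α
  lia

lemma IsEquioscillation.derivative_eval_node (h : IsEquioscillation (m + 2) α E q (-1) 1 z ε)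
    (hE : 0 ≤ E) {i : ℕ} (hi : i ≤ m) (hne : z (i + 1) ≠ α) :
    (derivative q).eval (z (i + 1)) = SignType.sign (z (i + 1) - α) := by
  refine derivative_eval_eq_sign h.abs_residual_le ⟨?_, ?_⟩ hne
    ((h.abs_residual_eq (by lia)).trans (abs_of_nonneg hE))
  · exact (h.mem_Icc i (by lia)).1.trans_lt
      (h.strictMonoOn (by simp only [mem_Iic]; lia) (by simp only [mem_Iic]; lia) i.lt_succ_self)
  · exact (h.strictMonoOn (by simp only [mem_Iic]; lia) (by simp only [mem_Iic]; lia)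
      (i + 1).lt_succ_self).trans_le (h.mem_Icc (i + 2) (by lia)).2

lemma derivative_derivative_minimaxPoly_ne_zero (hn : 2 ≤ n) (hα : α ∈ Ioo (-1 : ℝ) 1) :
    derivative (derivative (minimaxPoly n α)) ≠ 0 := by
  intro h0
  obtain ⟨m, rfl⟩ := Nat.exists_eq_add_of_le' hn
  obtain ⟨z, ε, h⟩ := exists_isEquioscillation_minimaxPoly (one_le_two.trans hn) hα
  obtain ⟨i, hi, hne⟩ : ∃ i ≤ m + 1, z (i + 1) ≠ α := by
    by_contra! hall
    have h12 : z 1 < z 2 := h.strictMonoOn (by simp) (by simp) one_lt_two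
    exact h12.ne ((hall 0 (Nat.zero_le _)).trans (hall 1 (by lia)).symm)
  have hC := eq_C_of_natDegree_eq_zero (derivative_eq_zero.1 h0)
  have hi' := h.derivative_eval_node (minimaxError_pos _ hα).le hi hne
  rw [hC, eval_C] at hi'
  rw [hi'] at hC
  refine derivative_minimaxPoly_ne_C (by lia) hα ?_ hC
  rcases hne.lt_or_gt with hlt | hgt
  · simp [sign_neg (sub_neg.2 hlt)]
  · simp [sign_pos (sub_pos.2 hgt)]

/- If no node were the corner, the derivative of the minimax polynomial would take the value `-1` at
the interior nodes to the left of the corner, and the value `1` at those to its right and at `w`: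
too often for its degree. -/
lemma exists_node_eq_corner (hn : 2 ≤ n) (hα : α ∈ Ioo (-1 : ℝ) 1)
    (h : IsEquioscillation (n + 1) α (minimaxError n α) (minimaxPoly n α) (-1) 1 z ε)
    (hw : 1 < w) (hw' : (derivative (minimaxPoly n α)).eval w = 1) : ∃ j ≤ n + 1, z j = α := by
  classical
  by_contra! hne
  obtain ⟨m, rfl⟩ := Nat.exists_eq_add_of_le' hn
  have hsign : ∀ i < m + 2,
      (derivative (minimaxPoly (m + 2) α)).eval (z (i + 1)) = SignType.sign (z (i + 1) - α) :=
    fun i hi => h.derivative_eval_node (minimaxError_pos _ hα).le (by lia) (hne _ (by lia))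
  set x : ℕ → ℝ := fun i => if i < m + 2 then z (i + 1) else w
  have hxz : ∀ i < m + 2, x i = z (i + 1) := fun i hi => if_pos hi
  have hxw : x (m + 2) = w := if_neg (lt_irrefl _)
  have hmono : StrictMonoOn x (Iic (m + 2)) := by
    intro i _ k hk hik
    rw [mem_Iic] at hk
    rw [hxz i (by lia)]
    rcases hk.eq_or_lt with rfl | hk
    · exact hxw ▸ (h.mem_Icc _ (by lia)).2.trans_lt hw
    · rw [hxz k hk]
      exact h.strictMonoOn (by simp only [mem_Iic]; lia) (by simp only [mem_Iic]; lia) (by lia)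
  have hex : ∃ k, α < x k := ⟨m + 2, hxw ▸ hα.2.trans hw⟩
  have hk : Nat.find hex ≤ m + 2 := Nat.find_min' hex (hxw ▸ hα.2.trans hw)
  refine derivative_derivative_minimaxPoly_ne_zero hn hα ?_
  have hzero := derivative_eq_zero_of_eval_eq_zero
    (f := derivative (minimaxPoly (m + 2) α) + 1) (g := derivative (minimaxPoly (m + 2) α) - 1)
    (by simp) (by simpa using natDegree_derivative_derivative_minimaxPoly_le (m + 2) α)
    hmono (k := Nat.find hex) (fun i hi => ?_) (fun i hi => ?_) hk
  · simpa using hzero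
  · have hi' : i < m + 2 := hi.trans_le hk
    have hlt : z (i + 1) < α :=
      (not_lt.1 (hxz i hi' ▸ Nat.find_min hex hi)).lt_of_ne (hne _ (by lia))
    rw [hxz i hi', eval_add, hsign i hi', sign_neg (sub_neg.2 hlt)]
    simp
  · have hgt : α < x i := (Nat.find_spec hex).trans_le (hmono.monotoneOn hk hi.2 hi.1)
    rcases hi.2.eq_or_lt with rfl | hi'
    · simp [hxw, hw']
    · rw [hxz i hi'] at hgt ⊢
      rw [eval_sub, hsign i hi', sign_pos (sub_pos.2 hgt)]
      simp

lemma IsEquioscillation.sign_eq_of_node_eq_corner {j : ℕ}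
    (h : IsEquioscillation m α E q (-1) 1 z ε) (hα : α ∈ Ioo (-1 : ℝ) 1) (hj : j ≤ m)
    (hz : z j = α) : ε = -(-1) ^ j := by
  have hne : ε * (-1) ^ j ≠ 1 := fun h1 =>
    residual_self_ne hα h.abs_residual_le (by rw [← one_mul E, ← h1, ← h.residual_eq hj, hz])
  have habs : |ε * (-1) ^ j| = 1 := by simp [abs_mul, h.abs_sign]
  have heq := ((abs_eq zero_le_one).1 habs).resolve_left hne
  linear_combination (-1) ^ j * heq - ε * neg_one_pow_mul_self j

theorem exists_isEquioscillation_corner (hn : 2 ≤ n) (hα : α ∈ Ioo (-1 : ℝ) 1)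
    (hw : IsOutsideCritical n α w) :
    ∃ j ≤ n + 1, ∃ z, z j = α ∧
      IsEquioscillation (n + 1) α (minimaxError n α) (minimaxPoly n α) (-1) 1 z (-(-1) ^ j) := by
  have hn1 : 1 ≤ n := one_le_two.trans hn
  obtain ⟨z, ε, h⟩ := exists_isEquioscillation_minimaxPoly hn1 hα
  obtain ⟨j, hj, hz⟩ : ∃ j ≤ n + 1, z j = α := by
    rcases one_lt_or_one_lt_neg_of_isOutsideCritical hw with hw1 | hw1
    · exact exists_node_eq_corner hn hα h hw1 ((isOutsideCritical_iff_of_one_lt hα hw1).1 hw)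
    have hα' : -α ∈ Ioo (-1 : ℝ) 1 := ⟨neg_lt_neg hα.2, neg_lt.1 hα.1⟩
    have hrefl := h.reflect
    rw [neg_neg, ← minimaxPoly_neg hn1 hα, ← minimaxError_neg] at hrefl
    obtain ⟨k, -, hzk⟩ := exists_node_eq_corner hn hα' hrefl hw1
      ((isOutsideCritical_iff_of_one_lt hα' hw1).1 (isOutsideCritical_neg hn1 hα hw))
    exact ⟨n + 1 - k, Nat.sub_le _ _, neg_injective hzk⟩
  exact ⟨j, hj, z, hz, h.sign_eq_of_node_eq_corner hα hj hz ▸ h⟩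

end CornerNode

section Pieces

variable {n : ℕ} {α w x : ℝ}

/-- The polynomial that agrees to the left of the corner `α` with the residual of the minimax
polynomial divided by the minimax error. -/
noncomputable def leftPiece (n : ℕ) (α : ℝ) : ℝ[X] :=
  C (minimaxError n α)⁻¹ * (C α - X - minimaxPoly n α)

/-- The polynomial that agrees to the right of the corner `α` with the residual of the minimax
polynomial divided by the minimax error. -/
noncomputable def rightPiece (n : ℕ) (α : ℝ) : ℝ[X] :=
  C (minimaxError n α)⁻¹ * (X - C α - minimaxPoly n α)

lemma eval_leftPiece (hx : x ≤ α) :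
    (leftPiece n α).eval x = (minimaxError n α)⁻¹ * residual α (minimaxPoly n α) x := by
  simp [leftPiece, residual_of_le hx]

lemma eval_rightPiece (hx : α ≤ x) :
    (rightPiece n α).eval x = (minimaxError n α)⁻¹ * residual α (minimaxPoly n α) x := by
  simp [rightPiece, residual_of_ge hx]

lemma eval_leftPiece_sub_eval_rightPiece (n : ℕ) (α x : ℝ) :
    (leftPiece n α).eval x - (rightPiece n α).eval x = 2 * (minimaxError n α)⁻¹ * (α - x) := by
  simp only [leftPiece, rightPiece, eval_mul, eval_sub, eval_C, eval_X]
  ring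

lemma derivative_derivative_leftPiece (n : ℕ) (α : ℝ) :
    derivative (derivative (leftPiece n α)) =
      C (-(minimaxError n α)⁻¹) * derivative (derivative (minimaxPoly n α)) := by
  simp [leftPiece]

lemma derivative_derivative_rightPiece (n : ℕ) (α : ℝ) :
    derivative (derivative (rightPiece n α)) = derivative (derivative (leftPiece n α)) := by
  simp [leftPiece, rightPiece]

lemma natDegree_derivative_derivative_leftPiece_le (n : ℕ) (α : ℝ) :
    (derivative (derivative (leftPiece n α))).natDegree ≤ n - 2 := by
  rw [derivative_derivative_leftPiece]
  exact (natDegree_C_mul_le _ _).trans (natDegree_derivative_derivative_minimaxPoly_le n α)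

lemma derivative_derivative_leftPiece_ne_zero (hn : 2 ≤ n) (hα : α ∈ Ioo (-1 : ℝ) 1) :
    derivative (derivative (leftPiece n α)) ≠ 0 := by
  rw [derivative_derivative_leftPiece]
  refine mul_ne_zero (C_ne_zero.2 ?_) (derivative_derivative_minimaxPoly_ne_zero hn hα)
  exact neg_ne_zero.2 (inv_ne_zero (minimaxError_pos n hα).ne')

lemma derivative_rightPiece_eval_eq_zero (hα : α ∈ Ioo (-1 : ℝ) 1) (hw : 1 < w)
    (hcrit : IsOutsideCritical n α w) : (derivative (rightPiece n α)).eval w = 0 := by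
  simp [rightPiece, (isOutsideCritical_iff_of_one_lt hα hw).1 hcrit]

lemma abs_inv_mul_residual_le_one (hα : α ∈ Ioo (-1 : ℝ) 1) (hx : x ∈ Icc (-1 : ℝ) 1) :
    |(minimaxError n α)⁻¹ * residual α (minimaxPoly n α) x| ≤ 1 := by
  have hE := minimaxError_pos n hα
  rw [abs_mul, abs_of_pos (inv_pos.2 hE), inv_mul_le_one₀ hE]
  exact abs_residual_minimaxPoly_le n α hx

end Pieces

/-- The points `x 0 < ⋯ < x (n + 1)` of `[-1, 1]` include the corner, `x j = α`, and the residual of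
the minimax polynomial weakly alternates in sign at them, being nonpositive at the corner. Unlike
equioscillation, this survives small changes of the corner. -/
structure AlternatesAtCorner (n : ℕ) (α : ℝ) (j : ℕ) (x : ℕ → ℝ) : Prop where
  index_le : j ≤ n + 1
  strictMonoOn : StrictMonoOn x (Iic (n + 1))
  mem_Icc : ∀ i ≤ n + 1, x i ∈ Icc (-1 : ℝ) 1
  corner : x j = α
  nonneg : ∀ i ≤ n + 1, 0 ≤ -(-1) ^ j * (-1) ^ i * residual α (minimaxPoly n α) (x i)

lemma IsEquioscillation.alternatesAtCorner {n j : ℕ} {α : ℝ} {z : ℕ → ℝ} (hj : j ≤ n + 1)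
    (hz : z j = α)
    (h : IsEquioscillation (n + 1) α (minimaxError n α) (minimaxPoly n α) (-1) 1 z (-(-1) ^ j)) :
    AlternatesAtCorner n α j z :=
  ⟨hj, h.strictMonoOn, h.mem_Icc, hz, fun i hi => by
    rw [h.sign_mul_residual i hi]
    exact norm_nonneg _⟩

namespace AlternatesAtCorner

variable {n j k : ℕ} {α v w : ℝ} {x y : ℕ → ℝ}

lemma reflect (h : AlternatesAtCorner n α j x) (hn : 1 ≤ n) (hα : α ∈ Ioo (-1 : ℝ) 1) :
    AlternatesAtCorner n (-α) (n + 1 - j) (fun i => -x (n + 1 - i)) := by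
  refine ⟨Nat.sub_le _ _, fun i hi k hk hik => neg_lt_neg (h.strictMonoOn ?_ ?_ ?_),
    fun i _ => ?_, ?_, fun i hi => ?_⟩
  · exact Nat.sub_le _ _
  · exact Nat.sub_le _ _
  · rw [mem_Iic] at hi hk
    lia
  · have := h.mem_Icc (n + 1 - i) (Nat.sub_le _ _)
    exact ⟨neg_le_neg this.2, neg_le.2 this.1⟩
  · rw [Nat.sub_sub_self h.index_le, h.corner]
  · have := h.nonneg (n + 1 - i) (Nat.sub_le _ _)
    rw [minimaxPoly_neg hn hα, residual_neg, neg_neg, neg_one_pow_sub h.index_le]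
    rw [neg_one_pow_sub hi] at this
    linarith

lemma weaklyAlternates_leftPiece (h : AlternatesAtCorner n α j x) (hα : α ∈ Ioo (-1 : ℝ) 1) :
    WeaklyAlternates (-(-1) ^ j) (leftPiece n α) x 0 j := by
  refine ⟨h.strictMonoOn.mono fun i hi => hi.2.trans h.index_le, fun i hi => ?_⟩
  have hi' : i ≤ n + 1 := hi.2.trans h.index_le
  rw [eval_leftPiece (h.corner ▸ h.strictMonoOn.monotoneOn hi' h.index_le hi.2), mul_left_comm]
  exact mul_nonneg (inv_pos.2 (minimaxError_pos n hα)).le (h.nonneg i hi')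

lemma weaklyAlternates_rightPiece (h : AlternatesAtCorner n α j x) (hα : α ∈ Ioo (-1 : ℝ) 1) :
    WeaklyAlternates (-(-1) ^ j) (rightPiece n α) x j (n + 1) := by
  refine ⟨h.strictMonoOn.mono Icc_subset_Iic_self, fun i hi => ?_⟩
  rw [eval_rightPiece (h.corner ▸ h.strictMonoOn.monotoneOn h.index_le hi.2 hi.1), mul_left_comm]
  exact mul_nonneg (inv_pos.2 (minimaxError_pos n hα)).le (h.nonneg i hi.2)

lemma exists_derivative_rightPiece (h : AlternatesAtCorner n α j x) (hα : α ∈ Ioo (-1 : ℝ) 1)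
    (hw : 1 < w) (hsign : 0 ≤ (-1) ^ j * (-1) ^ (n + 1) * (derivative (rightPiece n α)).eval w) :
    ∃ y, WeaklyAlternates (- -(-1) ^ j) (derivative (rightPiece n α)) y j (n + 1) ∧ α < y j ∧
      y (n + 1) = w := by
  obtain ⟨y, hy, hxy, hyw⟩ := (h.weaklyAlternates_rightPiece hα).exists_derivative_append h.index_le
    ((h.mem_Icc _ le_rfl).2.trans_lt hw) (by rwa [neg_neg])
  exact ⟨y, hy, h.corner ▸ hxy j ⟨le_rfl, h.index_le⟩, hyw⟩

lemma exists_derivative_rightPiece_of_isOutsideCritical (h : AlternatesAtCorner n α j x)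
    (hα : α ∈ Ioo (-1 : ℝ) 1) (hw : 1 < w) (hcrit : IsOutsideCritical n α w) :
    ∃ y, WeaklyAlternates (- -(-1) ^ j) (derivative (rightPiece n α)) y j (n + 1) ∧ α < y j := by
  obtain ⟨y, hy, hαy, -⟩ := h.exists_derivative_rightPiece hα hw
    (by rw [derivative_rightPiece_eval_eq_zero hα hw hcrit, mul_zero])
  exact ⟨y, hy, hαy⟩

lemma index_le_degree (h : AlternatesAtCorner n α j x) (hn : 2 ≤ n) (hα : α ∈ Ioo (-1 : ℝ) 1) :
    j ≤ n := by
  by_contra hj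
  obtain rfl : j = n + 1 := h.index_le.antisymm (not_le.1 hj)
  obtain ⟨m, rfl⟩ := Nat.exists_eq_add_of_le' hn
  obtain ⟨u, hu, -⟩ := (h.weaklyAlternates_leftPiece hα).exists_derivative_derivative
  refine derivative_derivative_leftPiece_ne_zero hn hα (hu.eq_zero (by simp) ?_)
  exact (natDegree_derivative_derivative_leftPiece_le _ α).trans_lt (by lia)

lemma two_le_index (h : AlternatesAtCorner n α j x) (hn : 2 ≤ n) (hα : α ∈ Ioo (-1 : ℝ) 1)
    (hw : 1 < w) (hcrit : IsOutsideCritical n α w) : 2 ≤ j := by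
  by_contra hj
  obtain ⟨y, hy, -⟩ := h.exists_derivative_rightPiece_of_isOutsideCritical hα hw hcrit
  obtain ⟨u, hu, -⟩ := hy.exists_derivative
  rw [derivative_derivative_rightPiece] at hu
  refine derivative_derivative_leftPiece_ne_zero hn hα (hu.eq_zero (by simp) ?_)
  exact (natDegree_derivative_derivative_leftPiece_le n α).trans_lt (by lia)

lemma coeff_pos_of_one_lt (h : AlternatesAtCorner n α j x) (hn : 2 ≤ n) (hα : α ∈ Ioo (-1 : ℝ) 1)
    (hw : 1 < w) (hcrit : IsOutsideCritical n α w) :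
    0 < (-1) ^ (n + j) * (minimaxPoly n α).coeff n := by
  obtain ⟨k, rfl⟩ := Nat.exists_eq_add_of_le' (h.two_le_index hn hα hw hcrit)
  obtain ⟨y, hy, hαy⟩ := h.exists_derivative_rightPiece_of_isOutsideCritical hα hw hcrit
  obtain ⟨m, rfl⟩ := Nat.exists_eq_add_of_le' hn
  obtain ⟨u, hu⟩ := (h.weaklyAlternates_leftPiece hα).exists_derivative_derivative_append
    (s := 2) hy (derivative_derivative_rightPiece _ α).symm k.zero_le (by simp) (by lia)
    (h.corner ▸ hαy.le)
  have hpos := hu.coeff_pos (by simp) m.zero_le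
    (natDegree_derivative_derivative_leftPiece_le (m + 2) α)
    (derivative_derivative_leftPiece_ne_zero hn hα)
  rw [derivative_derivative_leftPiece, Nat.sub_zero, coeff_C_mul, coeff_derivative,
    coeff_derivative] at hpos
  have hfactor : 0 < (minimaxError (m + 2) α)⁻¹ * ((m + 1 : ℕ) + 1) * (m + 1) := by
    have := minimaxError_pos (m + 2) hα
    positivity
  refine pos_of_mul_pos_right (hpos.trans_eq ?_) hfactor.le
  ring

theorem mul_coeff_pos (h : AlternatesAtCorner n α j x) (hn : 2 ≤ n) (hα : α ∈ Ioo (-1 : ℝ) 1)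
    (hcrit : IsOutsideCritical n α w) :
    0 < w * ((-1) ^ (n + j) * (minimaxPoly n α).coeff n) := by
  rcases one_lt_or_one_lt_neg_of_isOutsideCritical hcrit with hw | hw
  · exact mul_pos (by linarith) (h.coeff_pos_of_one_lt hn hα hw hcrit)
  have hn1 : 1 ≤ n := one_le_two.trans hn
  have hpos := (h.reflect hn1 hα).coeff_pos_of_one_lt hn ⟨neg_lt_neg hα.2, neg_lt.1 hα.1⟩ hw
    (isOutsideCritical_neg hn1 hα hcrit)
  rw [coeff_minimaxPoly_neg hn1 hα, pow_add, neg_one_pow_sub h.index_le, pow_succ] at hpos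
  have hsq := neg_one_pow_mul_self n
  refine mul_pos_of_neg_of_neg (by linarith) ?_
  rcases neg_one_pow_eq_or ℝ n with hn' | hn' <;> rw [hn'] at hpos <;> rw [pow_add, hn'] <;>
    linarith

lemma index_le_index_of_one_lt (hx : AlternatesAtCorner n α j x) (hy : AlternatesAtCorner n α k y)
    (hn : 2 ≤ n) (hα : α ∈ Ioo (-1 : ℝ) 1) (hw : 1 < w) (hcrit : IsOutsideCritical n α w) :
    j ≤ k := by
  by_contra! hkj
  obtain ⟨u, hu, hαu⟩ := hy.exists_derivative_rightPiece_of_isOutsideCritical hα hw hcrit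
  obtain ⟨k, rfl⟩ := Nat.exists_eq_succ_of_ne_zero
    (two_pos.trans_le (hy.two_le_index hn hα hw hcrit)).ne'
  obtain ⟨s, hs, hsign⟩ : ∃ s ≤ 1, -(-1 : ℝ) ^ j = -(-1) ^ (k + 1) * (-1) ^ s :=
    ⟨(j + (k + 1)) % 2, by lia, by
      rw [neg_mul, ← pow_add]
      exact congrArg Neg.neg (neg_one_pow_congr (by grind))⟩
  have hkj' : k + 2 ≤ j := hkj
  have hleft := (hx.weaklyAlternates_leftPiece hα).mono le_rfl hkj'
  have hxu : x (k + 2) ≤ u (k + 1) := by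
    refine le_trans ?_ hαu.le
    exact hx.corner ▸ hx.strictMonoOn.monotoneOn (hkj'.trans hx.index_le) hx.index_le hkj'
  obtain ⟨t, ht⟩ := hleft.exists_derivative_derivative_append (c := n - s) (s := s)
    (by rwa [Nat.sub_add_cancel (by lia)]) (derivative_derivative_rightPiece n α).symm
    k.zero_le hsign (by lia) hxu
  refine derivative_derivative_leftPiece_ne_zero hn hα (ht.eq_zero (by simp) ?_)
  exact (natDegree_derivative_derivative_leftPiece_le n α).trans_lt (by lia)

theorem index_unique (hx : AlternatesAtCorner n α j x) (hy : AlternatesAtCorner n α k y)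
    (hn : 2 ≤ n) (hα : α ∈ Ioo (-1 : ℝ) 1) (hcrit : IsOutsideCritical n α w) : j = k := by
  rcases one_lt_or_one_lt_neg_of_isOutsideCritical hcrit with hw | hw
  · exact (hx.index_le_index_of_one_lt hy hn hα hw hcrit).antisymm
      (hy.index_le_index_of_one_lt hx hn hα hw hcrit)
  have hn1 : 1 ≤ n := one_le_two.trans hn
  have hα' : -α ∈ Ioo (-1 : ℝ) 1 := ⟨neg_lt_neg hα.2, neg_lt.1 hα.1⟩
  have hcrit' := isOutsideCritical_neg hn1 hα hcrit
  have hjk := (hx.reflect hn1 hα).index_le_index_of_one_lt (hy.reflect hn1 hα) hn hα' hw hcrit'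
  have hkj := (hy.reflect hn1 hα).index_le_index_of_one_lt (hx.reflect hn1 hα) hn hα' hw hcrit'
  have := hx.index_le
  have := hy.index_le
  lia

lemma derivative_rightPiece_eval_lt (h : AlternatesAtCorner n α j x) (hn : 2 ≤ n)
    (hα : α ∈ Ioo (-1 : ℝ) 1) (hw : 1 < w) (hwv : w < v) (hcrit : IsOutsideCritical n α v) :
    (-1) ^ j * (-1) ^ (n + 1) * (derivative (rightPiece n α)).eval w < 0 := by
  by_contra! hsign
  have hv := hw.trans hwv
  obtain ⟨y, hy, hαy, hyw⟩ := h.exists_derivative_rightPiece hα hw hsign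
  obtain ⟨k, rfl⟩ := Nat.exists_eq_add_of_le' (h.two_le_index hn hα hv hcrit)
  have hy' := hy.append (c := n + 2) (.singleton (w := v)
    (by rw [derivative_rightPiece_eval_eq_zero hα hv hcrit, mul_zero])) fun _ => hyw ▸ hwv
  obtain ⟨u, hu⟩ := (h.weaklyAlternates_leftPiece hα).exists_derivative_derivative_append
    (c := n - 1) (s := 2) (by rwa [show n - 1 + 2 + 1 = n + 2 by lia])
    (derivative_derivative_rightPiece n α).symm k.zero_le (by simp) (by lia)
    (by rw [if_pos h.index_le, h.corner]; exact hαy.le)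
  refine derivative_derivative_leftPiece_ne_zero hn hα (hu.eq_zero (by simp) ?_)
  exact (natDegree_derivative_derivative_leftPiece_le n α).trans_lt (by lia)

end AlternatesAtCorner

section Comparison

variable {n j : ℕ} {α β v w ε : ℝ} {x y : ℕ → ℝ}

lemma IsEquioscillation.nonneg_sub_of_abs_le_one {t : ℝ} {i : ℕ}
    (h : IsEquioscillation (n + 1) α (minimaxError n α) (minimaxPoly n α) (-1) 1 x ε)
    (hα : α ∈ Ioo (-1 : ℝ) 1) (hi : i ≤ n + 1) (ht : |t| ≤ 1) :
    0 ≤ -ε * (-1) ^ i * (t - (minimaxError n α)⁻¹ * residual α (minimaxPoly n α) (x i)) := by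
  have hnode : ε * (-1) ^ i * ((minimaxError n α)⁻¹ * residual α (minimaxPoly n α) (x i)) = 1 := by
    rw [mul_left_comm, h.sign_mul_residual i hi, inv_mul_cancel₀ (minimaxError_pos n hα).ne']
  have hle : ε * (-1) ^ i * t ≤ 1 :=
    (le_abs_self _).trans (by simpa [abs_mul, h.abs_sign] using ht)
  linarith

lemma IsEquioscillation.weaklyAlternates_leftPiece_sub (hα : α ∈ Ioo (-1 : ℝ) 1)
    (hβ : β ∈ Ioo (-1 : ℝ) 1) (hαβ : α ≤ β) (hj : j ≤ n + 1)
    (h : IsEquioscillation (n + 1) α (minimaxError n α) (minimaxPoly n α) (-1) 1 x ε)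
    (hx : x j = α) : WeaklyAlternates (-ε) (leftPiece n β - leftPiece n α) x 0 j := by
  refine ⟨h.strictMonoOn.mono fun i hi => hi.2.trans hj, fun i hi => ?_⟩
  have hi' : i ≤ n + 1 := hi.2.trans hj
  have hle : x i ≤ α := hx ▸ h.strictMonoOn.monotoneOn hi' hj hi.2
  rw [eval_sub, eval_leftPiece hle, eval_leftPiece (hle.trans hαβ)]
  exact h.nonneg_sub_of_abs_le_one hα hi' (abs_inv_mul_residual_le_one hβ (h.mem_Icc i hi'))

lemma IsEquioscillation.weaklyAlternates_rightPiece_sub (hα : α ∈ Ioo (-1 : ℝ) 1)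
    (hβ : β ∈ Ioo (-1 : ℝ) 1) (hαβ : α ≤ β) (hj : j ≤ n + 1)
    (h : IsEquioscillation (n + 1) β (minimaxError n β) (minimaxPoly n β) (-1) 1 y ε)
    (hy : y j = β) : WeaklyAlternates ε (rightPiece n β - rightPiece n α) y j (n + 1) := by
  refine ⟨h.strictMonoOn.mono Icc_subset_Iic_self, fun i hi => ?_⟩
  have hle : β ≤ y i := hy ▸ h.strictMonoOn.monotoneOn hj hi.2 hi.1
  rw [eval_sub, eval_rightPiece hle, eval_rightPiece (hαβ.trans hle)]
  have := h.nonneg_sub_of_abs_le_one hβ hi.2 (abs_inv_mul_residual_le_one (n := n) hα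
    (h.mem_Icc i hi.2))
  linarith

lemma leftPiece_sub_ne_zero_or_rightPiece_sub_ne_zero (hβ : β ∈ Ioo (-1 : ℝ) 1) (hαβ : α < β) :
    leftPiece n β - leftPiece n α ≠ 0 ∨ rightPiece n β - rightPiece n α ≠ 0 := by
  by_contra! h
  have hα' := eval_leftPiece_sub_eval_rightPiece n α α
  have hβ' := eval_leftPiece_sub_eval_rightPiece n β α
  rw [sub_eq_zero.1 h.1, sub_eq_zero.1 h.2, hα', sub_self, mul_zero] at hβ'
  have hpos : 0 < 2 * (minimaxError n β)⁻¹ * (β - α) :=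
    mul_pos (mul_pos two_pos (inv_pos.2 (minimaxError_pos n hβ))) (sub_pos.2 hαβ)
  exact hpos.ne hβ'

/- The normalized residuals are compared on each side of the corners: at the nodes belonging to `α`
on the left, and at those belonging to `β` and at `w` on the right. If `w ≤ v`, the common second
derivative of the two differences alternates too often. -/
theorem lt_of_isOutsideCritical (hn : 2 ≤ n) (hα : α ∈ Ioo (-1 : ℝ) 1) (hβ : β ∈ Ioo (-1 : ℝ) 1)
    (hαβ : α < β) (hj : j ≤ n + 1) (hxj : x j = α) (hyj : y j = β)
    (hx : IsEquioscillation (n + 1) α (minimaxError n α) (minimaxPoly n α) (-1) 1 x (-(-1) ^ j))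
    (hy : IsEquioscillation (n + 1) β (minimaxError n β) (minimaxPoly n β) (-1) 1 y (-(-1) ^ j))
    (hv : 1 < v) (hcritv : IsOutsideCritical n α v) (hw : 1 < w)
    (hcritw : IsOutsideCritical n β w) : v < w := by
  by_contra! hwv
  have hcorner := hx.alternatesAtCorner hj hxj
  have hjn := hcorner.index_le_degree hn hα
  have hL := hx.weaklyAlternates_leftPiece_sub hα hβ hαβ.le hj hxj
  have hR := hy.weaklyAlternates_rightPiece_sub hα hβ hαβ.le hj hyj
  have hdd : derivative (derivative (leftPiece n β - leftPiece n α)) =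
      derivative (derivative (rightPiece n β - rightPiece n α)) := by
    simp only [derivative_sub, derivative_derivative_rightPiece]
  have hsign : (-1) ^ j * (-1) ^ (n + 1) * (derivative (rightPiece n α)).eval w ≤ 0 := by
    rcases hwv.lt_or_eq with hwv | rfl
    · exact (hcorner.derivative_rightPiece_eval_lt hn hα hw hwv hcritv).le
    · rw [derivative_rightPiece_eval_eq_zero hα hv hcritv, mul_zero]
  obtain ⟨u, hu, hyu, -⟩ := hR.exists_derivative_append hj ((hy.mem_Icc _ le_rfl).2.trans_lt hw) (by
    rw [derivative_sub, eval_sub, derivative_rightPiece_eval_eq_zero hβ hw hcritw]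
    linarith)
  have hdd0 : derivative (derivative (leftPiece n β - leftPiece n α)) = 0 := by
    obtain ⟨k, rfl⟩ := Nat.exists_eq_add_of_le' (hcorner.two_le_index hn hα hv hcritv)
    obtain ⟨t, ht⟩ := hL.exists_derivative_derivative_append (c := n - 1) (s := 1)
      (by rwa [show n - 1 + 1 + 1 = n + 1 by lia]) hdd k.zero_le (by simp) le_rfl
      (hxj ▸ (hαβ.trans (hyj ▸ hyu _ ⟨le_rfl, hj⟩)).le)
    refine ht.eq_zero (by simp) (lt_of_le_of_lt ?_ (by lia : max (n - 2) (n - 2) < n - 1))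
    rw [derivative_sub, derivative_sub]
    exact natDegree_sub_le_of_le (natDegree_derivative_derivative_leftPiece_le n β)
      (natDegree_derivative_derivative_leftPiece_le n α)
  rcases leftPiece_sub_ne_zero_or_rightPiece_sub_ne_zero (n := n) hβ hαβ with hne | hne
  · exact hne (hL.eq_zero_of_derivative_derivative_eq_zero (by simp)
      (by simpa using hcorner.two_le_index hn hα hv hcritv) hdd0)
  · have hR' := hu.eq_zero (by simp) (by rw [derivative_eq_zero.1 (hdd ▸ hdd0)]; lia)
    exact hne (hR.eq_zero (by simp) (by rw [derivative_eq_zero.1 hR']; lia))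

end Comparison

section StrongUniqueness

variable {x : ℕ → ℝ} {n m a b : ℕ} {α E A B ε : ℝ} {p : ℝ[X]}

-- A combination of the signed values with positive weights vanishes, so that lower bounds for
-- all of them entail upper bounds.
lemma exists_abs_eval_le_mul_of_neg_le (hab : a ≤ b) (hx : StrictMonoOn x (Icc a b)) :
    ∃ K, ∀ (f : ℝ[X]) (σ δ : ℝ), f.natDegree < b - a → |σ| = 1 → 0 ≤ δ →
      (∀ i ∈ Finset.Icc a b, -δ ≤ σ * (-1) ^ i * f.eval (x i)) →
      ∀ i ∈ Finset.Icc a b, |f.eval (x i)| ≤ K * δ := by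
  obtain ⟨c, hc, hsum⟩ := exists_pos_weights_coeff_eq hab hx
  refine ⟨(∑ i ∈ Finset.Icc a b, c i) * (∑ i ∈ Finset.Icc a b, (c i)⁻¹) + 1,
    fun f σ δ hf hσ hδ hlow i hi => ?_⟩
  set s := Finset.Icc a b
  set v : ℕ → ℝ := fun i => σ * (-1) ^ i * f.eval (x i)
  have hweighted : ∑ k ∈ s, c k * (v k + δ) = (∑ k ∈ s, c k) * δ := by
    have h0 := hsum f hf.le
    rw [coeff_eq_zero_of_natDegree_lt hf, mul_zero] at h0
    calc ∑ k ∈ s, c k * (v k + δ)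
        = σ * (∑ k ∈ s, c k * ((-1) ^ k * f.eval (x k))) + (∑ k ∈ s, c k) * δ := by
          rw [Finset.mul_sum, Finset.sum_mul, ← Finset.sum_add_distrib]
          exact Finset.sum_congr rfl fun k _ => by simp only [v]; ring
      _ = (∑ k ∈ s, c k) * δ := by rw [← h0, mul_zero, zero_add]
  have hterm : c i * (v i + δ) ≤ (∑ k ∈ s, c k) * δ :=
    hweighted ▸ Finset.single_le_sum (f := fun k => c k * (v k + δ))
      (fun k hk => mul_nonneg (hc k hk).le (neg_le_iff_add_nonneg.1 (hlow k hk))) hi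
  have hW : 0 ≤ (∑ k ∈ s, c k) * δ := mul_nonneg (Finset.sum_nonneg fun k hk => (hc k hk).le) hδ
  have hinv : (c i)⁻¹ ≤ ∑ k ∈ s, (c k)⁻¹ :=
    Finset.single_le_sum (f := fun k => (c k)⁻¹) (fun k hk => (inv_pos.2 (hc k hk)).le) hi
  have hupper : v i + δ ≤ (∑ k ∈ s, c k) * δ * ∑ k ∈ s, (c k)⁻¹ := calc
    v i + δ ≤ (∑ k ∈ s, c k) * δ * (c i)⁻¹ := by
      rwa [← div_eq_mul_inv, le_div_iff₀' (hc i hi)]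
    _ ≤ _ := mul_le_mul_of_nonneg_left hinv hW
  have habs : |f.eval (x i)| = |v i| := by simp [v, abs_mul, hσ]
  rw [habs, abs_le]
  constructor <;> linarith [hlow i hi]

lemma exists_abs_apply_le_mul_of_abs_eval_le {s : Finset ℕ} (hx : InjOn x s)
    (Λ : ℝ[X] →ₗ[ℝ] ℝ) :
    ∃ K, ∀ (f : ℝ[X]) (δ : ℝ), f.degree < s.card → (∀ i ∈ s, |f.eval (x i)| ≤ δ) →
      |Λ f| ≤ K * δ := by
  refine ⟨∑ i ∈ s, |Λ (Lagrange.basis s x i)|, fun f δ hf hbound => ?_⟩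
  have hΛ : Λ f = ∑ i ∈ s, f.eval (x i) * Λ (Lagrange.basis s x i) := by
    conv_lhs => rw [Lagrange.eq_interpolate hx hf, Lagrange.interpolate_apply]
    simp only [map_sum, ← smul_eq_C_mul, map_smul, smul_eq_mul]
  rw [hΛ, Finset.sum_mul]
  refine (Finset.abs_sum_le_sum_abs _ _).trans (Finset.sum_le_sum fun i hi => ?_)
  rw [abs_mul, mul_comm]
  exact mul_le_mul_of_nonneg_left (hbound i hi) (abs_nonneg _)

lemma IsEquioscillation.exists_abs_apply_sub_le
    (h : IsEquioscillation (n + 1) α E p A B x ε) (hp : p.natDegree ≤ n) (Λ : ℝ[X] →ₗ[ℝ] ℝ) :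
    ∃ K, ∀ (q : ℝ[X]) (δ : ℝ), q.natDegree ≤ n → 0 ≤ δ →
      (∀ y ∈ Icc A B, |residual α q y| ≤ E + δ) → |Λ q - Λ p| ≤ K * δ := by
  have hmono : StrictMonoOn x (Icc 0 (n + 1)) := h.strictMonoOn.mono Icc_subset_Iic_self
  obtain ⟨K, hK⟩ := exists_abs_eval_le_mul_of_neg_le (Nat.zero_le _) hmono
  obtain ⟨L, hL⟩ := exists_abs_apply_le_mul_of_abs_eval_le (s := Finset.Icc 0 (n + 1))
    (by rw [Finset.coe_Icc]; exact hmono.injOn) Λ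
  refine ⟨L * K, fun q δ hq hδ hres => ?_⟩
  have hdeg : (q - p).natDegree ≤ n := natDegree_sub_le_of_le hq hp |>.trans (max_self n).le
  rw [← map_sub, mul_assoc]
  refine hL _ _ ?_ (hK _ ε δ (by lia) h.abs_sign hδ fun i hi => ?_)
  · refine (degree_le_of_natDegree_le hdeg).trans_lt ?_
    rw [Nat.card_Icc]
    exact_mod_cast (by lia : n < n + 1 + 1 - 0)
  have hi' : i ≤ n + 1 := (Finset.mem_Icc.1 hi).2
  have hqi : ε * (-1) ^ i * residual α q (x i) ≤ E + δ := by
    refine (le_abs_self _).trans ?_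
    simpa [abs_mul, h.abs_sign] using hres _ (h.mem_Icc i hi')
  have hpi := h.sign_mul_residual i hi'
  simp only [residual, eval_sub] at hqi hpi ⊢
  linarith

end StrongUniqueness

section Continuity

variable {n : ℕ} {α : ℝ}

lemma approxError_le_approxError_add (α β : ℝ) (q : ℝ[X]) :
    approxError α q ≤ approxError β q + |β - α| := by
  refine approxError_le fun x hx => ?_
  have hshift : |(|x - α| - |x - β|)| ≤ |β - α| := by
    simpa using abs_abs_sub_abs_le_abs_sub (x - α) (x - β)
  calc |residual α q x| = |residual β q x + (|x - α| - |x - β|)| := by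
        rw [residual, residual]; ring_nf
    _ ≤ |residual β q x| + |(|x - α| - |x - β|)| := abs_add_le _ _
    _ ≤ approxError β q + |β - α| := add_le_add (abs_residual_le_approxError β q hx) hshift

lemma approxError_minimaxPoly_le (n : ℕ) (α β : ℝ) :
    approxError α (minimaxPoly n β) ≤ minimaxError n α + 2 * |β - α| := by
  have h1 := approxError_le_approxError_add α β (minimaxPoly n β)
  have h2 : minimaxError n β ≤ _ := minimaxError_le_approxError (natDegree_minimaxPoly_le n α)
  have h3 := approxError_le_approxError_add β α (minimaxPoly n α)
  rw [abs_sub_comm] at h3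
  rw [minimaxError] at h2 ⊢
  linarith

lemma continuousAt_apply_minimaxPoly (hn : 1 ≤ n) (hα : α ∈ Ioo (-1 : ℝ) 1)
    (Λ : ℝ[X] →ₗ[ℝ] ℝ) : ContinuousAt (fun β => Λ (minimaxPoly n β)) α := by
  obtain ⟨z, ε, h⟩ := exists_isEquioscillation_minimaxPoly hn hα
  obtain ⟨K, hK⟩ := h.exists_abs_apply_sub_le (natDegree_minimaxPoly_le n α) Λ
  refine continuousAt_of_locally_lipschitz one_pos (K * 2) fun β _ => ?_
  rw [Real.dist_eq, Real.dist_eq, mul_assoc]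
  exact hK _ _ (natDegree_minimaxPoly_le n β) (by positivity) fun x hx =>
    (abs_residual_le_approxError α _ hx).trans (approxError_minimaxPoly_le n α β)

lemma continuousAt_coeff_minimaxPoly (hn : 1 ≤ n) (hα : α ∈ Ioo (-1 : ℝ) 1) (k : ℕ) :
    ContinuousAt (fun β => (minimaxPoly n β).coeff k) α :=
  continuousAt_apply_minimaxPoly hn hα (lcoeff ℝ k)

lemma continuousAt_residual_minimaxPoly (hn : 1 ≤ n) (hα : α ∈ Ioo (-1 : ℝ) 1) {g : ℝ → ℝ}
    (hg : ContinuousAt g α) :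
    ContinuousAt (fun β => residual β (minimaxPoly n β) (g β)) α := by
  have heval : ∀ β, (minimaxPoly n β).eval (g β) =
      ∑ k ∈ Finset.range (n + 1), (minimaxPoly n β).coeff k * g β ^ k := fun β =>
    eval_eq_sum_range' (Nat.lt_succ_of_le (natDegree_minimaxPoly_le n β)) _
  have hcoeff := continuousAt_coeff_minimaxPoly hn hα
  simp only [residual, heval]
  fun_prop

end Continuity

section CornerIndex

variable {n j : ℕ} {α v : ℝ} {z : ℕ → ℝ}

lemma continuous_update_apply (z : ℕ → ℝ) (j i : ℕ) :
    Continuous fun β => Function.update z j β i :=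
  continuous_pi_iff.1 ((continuous_const (y := z)).update j continuous_id) i

lemma eventually_strictMonoOn_update {m : ℕ} (hz : StrictMonoOn z (Iic m)) (j : ℕ) :
    ∀ᶠ β in nhds (z j), StrictMonoOn (Function.update z j β) (Iic m) := by
  refine (Filter.eventually_all_finite (finite_Iic m)).2 fun i hi =>
    (Filter.eventually_all_finite (finite_Iic m)).2 fun k hk =>
      Filter.eventually_imp_distrib_left.2 fun hik => ?_
  refine (continuous_update_apply z j i).continuousAt.eventually_lt
    (continuous_update_apply z j k).continuousAt ?_
  simpa only [Function.update_eq_self] using hz hi hk hik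

lemma IsEquioscillation.eventually_alternatesAtCorner (hn : 1 ≤ n) (hα : α ∈ Ioo (-1 : ℝ) 1)
    (hj : j ≤ n + 1) (hz : z j = α)
    (h : IsEquioscillation (n + 1) α (minimaxError n α) (minimaxPoly n α) (-1) 1 z (-(-1) ^ j)) :
    ∀ᶠ β in nhds α, AlternatesAtCorner n β j (Function.update z j β) := by
  subst hz
  have hpos : ∀ᶠ β in nhds (z j), ∀ i ∈ Iic (n + 1),
      0 < -(-1) ^ j * (-1) ^ i * residual β (minimaxPoly n β) (Function.update z j β i) := by
    refine (Filter.eventually_all_finite (finite_Iic _)).2 fun i hi => ?_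
    refine ((continuousAt_residual_minimaxPoly hn hα
      (continuous_update_apply z j i).continuousAt).const_mul _).eventually_const_lt ?_
    simp only [Function.update_eq_self, h.sign_mul_residual i hi]
    exact minimaxError_pos n hα
  filter_upwards [eventually_strictMonoOn_update h.strictMonoOn j, hpos, Icc_mem_nhds hα.1 hα.2]
    with β hmono hres hβ
  refine ⟨hj, hmono, fun i hi => ?_, Function.update_self _ _ _, fun i hi => (hres i hi).le⟩
  rcases eq_or_ne i j with rfl | hij
  · rwa [Function.update_self]
  · rw [Function.update_of_ne hij]
    exact h.mem_Icc i hi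

lemma IsEquioscillation.eventually_index_eq (hn : 2 ≤ n) (hα : α ∈ Ioo (-1 : ℝ) 1)
    (hj : j ≤ n + 1) (hz : z j = α)
    (h : IsEquioscillation (n + 1) α (minimaxError n α) (minimaxPoly n α) (-1) 1 z (-(-1) ^ j))
    (hv : IsOutsideCritical n α v) :
    ∀ᶠ β in nhds α, ∀ k y w, AlternatesAtCorner n β k y → IsOutsideCritical n β w →
      k = j ∧ 0 < w * v := by
  have hn1 : 1 ≤ n := one_le_two.trans hn
  have hsignα := (h.alternatesAtCorner hj hz).mul_coeff_pos hn hα hv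
  have hcoeff : ∀ᶠ β in nhds α, 0 < (minimaxPoly n β).coeff n * (minimaxPoly n α).coeff n := by
    refine ((continuousAt_coeff_minimaxPoly hn1 hα n).mul_const _).eventually_const_lt ?_
    exact mul_self_pos.2 fun h0 => by simp [h0] at hsignα
  filter_upwards [h.eventually_alternatesAtCorner hn1 hα hj hz, hcoeff, Ioo_mem_nhds hα.1 hα.2]
    with β hcorner hcoeffβ hβ k y w hk hw
  obtain rfl : k = j := hk.index_unique hcorner hn hβ hw
  refine ⟨rfl, pos_of_mul_pos_left ?_ hcoeffβ.le⟩
  have hprod := mul_pos (hk.mul_coeff_pos hn hβ hw) hsignα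
  refine hprod.trans_eq ?_
  linear_combination (w * v * ((minimaxPoly n β).coeff n * (minimaxPoly n α).coeff n)) *
    neg_one_pow_mul_self (n + k)

lemma exists_common_index_and_side (hn : 2 ≤ n) {I : Set ℝ} (hI : I.OrdConnected)
    (hsub : I ⊆ Ioo (-1 : ℝ) 1) {w : ℝ → ℝ} (hw : ∀ α ∈ I, IsOutsideCritical n α (w α)) :
    ∃ j ≤ n + 1, (∀ α ∈ I, ∃ z, z j = α ∧ IsEquioscillation (n + 1) α (minimaxError n α)
      (minimaxPoly n α) (-1) 1 z (-(-1) ^ j)) ∧ ((∀ α ∈ I, 1 < w α) ∨ ∀ α ∈ I, 1 < -w α) := by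
  rcases I.eq_empty_or_nonempty with rfl | ⟨α₀, hα₀⟩
  · exact ⟨0, Nat.zero_le _, by simp⟩
  choose J hJ z hzJ hz using fun α : I => exists_isEquioscillation_corner hn (hsub α.2) (hw α α.2)
  have hloc : IsLocallyConstant fun α : I => (J α, 0 < w α) := by
    refine (IsLocallyConstant.iff_eventually_eq _).2 fun α => ?_
    filter_upwards [continuous_subtype_val.continuousAt.eventually
      ((hz α).eventually_index_eq hn (hsub α.2) (hJ α) (hzJ α) (hw α α.2))] with β hβ
    obtain ⟨hindex, hside⟩ := hβ _ _ _ ((hz β).alternatesAtCorner (hJ β) (hzJ β)) (hw β β.2)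
    exact Prod.ext hindex (propext (pos_iff_pos_of_mul_pos hside))
  have : PreconnectedSpace I := Subtype.preconnectedSpace hI.isPreconnected
  have hconst : ∀ α : I, J α = J ⟨α₀, hα₀⟩ ∧ (0 < w α) = (0 < w α₀) := fun α =>
    Prod.mk.inj (hloc.apply_eq_of_preconnectedSpace α ⟨α₀, hα₀⟩)
  refine ⟨J ⟨α₀, hα₀⟩, hJ _, fun α hα => ⟨z ⟨α, hα⟩, ?_⟩, ?_⟩
  · rw [← (hconst ⟨α, hα⟩).1]
    exact ⟨hzJ ⟨α, hα⟩, hz ⟨α, hα⟩⟩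
  have hpos : ∀ α ∈ I, (0 < w α ↔ 0 < w α₀) := fun α hα =>
    (hconst ⟨α, hα⟩).2.to_iff
  have hside := fun α hα => one_lt_or_one_lt_neg_of_isOutsideCritical (hw α hα)
  by_cases h0 : 0 < w α₀
  · exact Or.inl fun α hα => (hside α hα).resolve_right fun h => by
      linarith [(hpos α hα).2 h0]
  · exact Or.inr fun α hα => (hside α hα).resolve_left fun h =>
      h0 ((hpos α hα).1 (one_pos.trans h))

end CornerIndex

lemma IsEquioscillation.reflect_minimaxPoly {n j : ℕ} {α : ℝ} {z : ℕ → ℝ} (hn : 1 ≤ n)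
    (hα : α ∈ Ioo (-1 : ℝ) 1) (hj : j ≤ n + 1)
    (h : IsEquioscillation (n + 1) α (minimaxError n α) (minimaxPoly n α) (-1) 1 z (-(-1) ^ j)) :
    IsEquioscillation (n + 1) (-α) (minimaxError n (-α)) (minimaxPoly n (-α)) (-1) 1
      (fun i => -z (n + 1 - i)) (-(-1) ^ (n + 1 - j)) := by
  have hrefl := h.reflect
  rwa [neg_neg, ← minimaxPoly_neg hn hα, ← minimaxError_neg, neg_mul, mul_comm,
    ← neg_one_pow_sub hj] at hrefl

theorem strictMonoOn_of_isOutsideCritical {n : ℕ} (hn : 2 ≤ n) {I : Set ℝ} (hI : I.OrdConnected)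
    (hsub : I ⊆ Ioo (-1 : ℝ) 1) {w : ℝ → ℝ} (hw : ∀ α ∈ I, IsOutsideCritical n α (w α)) :
    StrictMonoOn w I := by
  have hn1 : 1 ≤ n := one_le_two.trans hn
  obtain ⟨j, hj, hosc, hside⟩ := exists_common_index_and_side hn hI hsub hw
  intro α hα β hβ hαβ
  obtain ⟨x, hxj, hx⟩ := hosc α hα
  obtain ⟨y, hyj, hy⟩ := hosc β hβ
  rcases hside with hright | hleft
  · exact lt_of_isOutsideCritical hn (hsub hα) (hsub hβ) hαβ hj hxj hyj hx hy
      (hright α hα) (hw α hα) (hright β hβ) (hw β hβ)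
  · have hneg : ∀ γ ∈ I, -γ ∈ Ioo (-1 : ℝ) 1 := fun γ hγ =>
      ⟨neg_lt_neg (hsub hγ).2, neg_lt.1 (hsub hγ).1⟩
    refine neg_lt_neg_iff.1 (lt_of_isOutsideCritical hn (hneg β hβ) (hneg α hα) (neg_lt_neg hαβ)
      (Nat.sub_le _ j) ?_ ?_ (hy.reflect_minimaxPoly hn1 (hsub hβ) hj)
      (hx.reflect_minimaxPoly hn1 (hsub hα) hj) (hleft β hβ)
      (isOutsideCritical_neg hn1 (hsub hβ) (hw β hβ)) (hleft α hα)
      (isOutsideCritical_neg hn1 (hsub hα) (hw α hα)))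
    · rw [Nat.sub_sub_self hj, hyj]
    · rw [Nat.sub_sub_self hj, hxj]

end Checkmark

theorem mainTheorem5 (n : ℕ) (hn : 2 ≤ n) :
    (∀ α ∈ Set.Ioo (-1 : ℝ) 1, {-1, 1} ⊆ alternationSet n α →
      ¬ IsVShapeTip (n - 1) α → ¬ InVShape n α → ∃ w : ℝ, IsOutsideCritical n α w) ∧
    (∀ I : Set ℝ, I.OrdConnected → I ⊆ Set.Ioo (-1 : ℝ) 1 →
      ∀ w : ℝ → ℝ, (∀ α ∈ I, IsOutsideCritical n α (w α)) → StrictMonoOn w I) :=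
  ⟨fun _ hα hA htip hV => Checkmark.exists_isOutsideCritical hn hα hA htip hV,
    fun _ hI hsub _ hw => Checkmark.strictMonoOn_of_isOutsideCritical hn hI hsub hw⟩
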